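/- Let $I=(1,2)$, $H(r)=2(1-\tfrac1r)$, so that $\partial_rH=\tfrac{2}{r^2}$, and for constants $a,b,\gamma>0$ put $$h(\ell)=a\ell e^{-b/\ell},\qquad g(\ell)=h(\ell)-\tfrac{\ell^2}{4}.$$ For $\lambda>0$, the *electron system* for $\varphi\in H^2(I)$ is $$-\tfrac1{r^2}\partial_r(r^2\partial_r\varphi)-g(\lambda\partial_rH)\varphi=0\ \text{ in } I,\qquad \varphi(1)=0,\qquad \varphi>0\ \text{ in } I,$$ $$\partial_r\varphi(2)+\tfrac\lambda4\varphi(2)-a\gamma\tfrac\lambda2e^{-\lambda/2}\int_1^2e^{-\frac{br^2}{2\lambda}}e^{\lambda/r}\varphi(r)\,dr=0 ,$$ and the *adjoint problem* for $\psi\in H^2(I)$ is $$-\tfrac1{r^2}\partial_r(r^2\partial_r\psi)-g(\lambda\partial_rH)\psi-h(\lambda\partial_rH)e^{-\frac\lambda2H}\gamma e^{\frac\lambda2}\psi(2)=0\ \text{ in } I,\qquad \psi(1)=0,\quad \partial_r\psi(2)+\tfrac\lambda4\psi(2)=0 .$$ The *sparking parameter set* $\mathscr S$ is the set of all $(a,b,\gamma)\in(0,\infty)^3$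 for which the electron system has a solution $\varphi\in H^2(I)$ for some $\lambda>0$. For $(a,b,\gamma)\in\mathscr S$ the *sparking voltage* $\lambda^\dagger=\lambda^\dagger(a,b,\gamma)$ is the infimum of all such $\lambda>0$. For solutions $\varphi$ of the electron system and $\psi$ of the adjoint problem with voltage $\lambda$, put $$\begin{aligned}F=&-\gamma e^{\frac\lambda2}\int_1^2r^2\psi(2)\Big\{h'(\lambda\partial_rH)\,\partial_rH-h(\lambda\partial_rH)\tfrac H2\Big\}e^{-\frac\lambda2H}\varphi\,dr\\&-\int_1^2r^2\psi\,g'(\lambda\partial_rH)\,\partial_rH\,\varphi\,dr+\psi(2)\Big\{\varphi(2)-2\partial_r\varphi(2)-\tfrac\lambda2\varphi(2)\Big\}.\end{aligned}$$ The *transversality condition* holds at $\lambda^\dagger$ if $\lambda^\dagger>0$, at $\lambda=\lambda^\dagger$ the electron system has a solution $\varphi$ and the adjoint problem has a solution $\psi\not\equiv0$, and $F\neq0$ for all such $\varphi,\psi$. **Theorem.** The sparking parameter set $\mathscr S$ contains the set $$\Gamma=\Big\{(a,b,\gamma)\in(0,\infty)^3:\ \gamma>\tfrac1a,\ b>\tfrac4e\,a\Big\}.$$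 Furthermore, for (Lebesgue-)almost every $(a,b,\gamma)\in\Gamma$ the transversality condition holds at the sparking voltage $\lambda^\dagger(a,b,\gamma)$. -/

import Mathlib

open MeasureTheory Set
open scoped ContDiff

noncomputable section

namespace GasDischarge

/-- The function `v` is the weak derivative of `u` on the interval `I = (1,2)`: both are locally
integrable on `I` and `∫_I u η' = - ∫_I v η` for every test function `η ∈ C_c^∞(I)`. -/
def HasWeakDeriv (u v : ℝ → ℝ) : Prop :=
  LocallyIntegrableOn u (Ioo 1 2) ∧ LocallyIntegrableOn v (Ioo 1 2) ∧
    ∀ η : ℝ → ℝ, ContDiff ℝ ∞ η → HasCompactSupport η → tsupport η ⊆ Ioo 1 2 →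
      ∫ r in Ioo (1 : ℝ) 2, u r * deriv η r = - ∫ r in Ioo (1 : ℝ) 2, v r * η r

/-- The function `u` is the continuous representative on `[1,2]` of an element of the Sobolev space
`H²(I)`, `I = (1,2)`: `u` and its first and second weak derivatives are square integrable on `I`.
Every element of `H²(I)` has exactly one representative that is continuous on `[1,2]`; the values
of `u` outside `[1,2]` play no role. The weight `r²` in the norm of the space is bounded above and
below on `I`, and so does not affect membership. -/
def MemH2 (u : ℝ → ℝ) : Prop :=
  ContinuousOn u (Icc 1 2) ∧ ∃ u₁ u₂ : ℝ → ℝ,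
    HasWeakDeriv u u₁ ∧ HasWeakDeriv u₁ u₂ ∧
      MemLp u 2 (volume.restrict (Ioo 1 2)) ∧
      MemLp u₁ 2 (volume.restrict (Ioo 1 2)) ∧
      MemLp u₂ 2 (volume.restrict (Ioo 1 2))

/-- The derivative on `[1,2]`, one-sided at the end points. The continuous representative of an
element of `H²(I)` is continuously differentiable on `[1,2]`, so for such functions this is the
continuous representative of the weak derivative, and its value at `2` is the trace. -/
def dr (u : ℝ → ℝ) (r : ℝ) : ℝ := derivWithin u (Icc 1 2) r

/-- `-(1/r²) ∂_r (r² ∂_r u) = f` almost everywhere in `I`, the outer derivative being weak. -/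
def NegRadialLaplacianEq (u f : ℝ → ℝ) : Prop :=
  ∃ q : ℝ → ℝ, HasWeakDeriv (fun r => r ^ 2 * dr u r) q ∧
    ∀ᵐ r ∂(volume.restrict (Ioo (1 : ℝ) 2)), -(1 / r ^ 2) * q r = f r

/-- The ionization rate `h(ℓ) = a ℓ exp(-b/ℓ)`. -/
def h (a b ℓ : ℝ) : ℝ := a * ℓ * Real.exp (-b / ℓ)

/-- `g(ℓ) = h(ℓ) - ℓ²/4`. -/
def g (a b ℓ : ℝ) : ℝ := h a b ℓ - ℓ ^ 2 / 4

/-- The harmonic function `H` with `H = 0` on the anode `r = 1` and `H = 1` on the cathode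
`r = 2`. -/
def H (r : ℝ) : ℝ := 2 * (1 - 1 / r)

/-- The radial derivative `∂_r H = 2 / r²`. -/
def dH (r : ℝ) : ℝ := 2 / r ^ 2

theorem hasDerivAt_H {r : ℝ} (hr : r ≠ 0) : HasDerivAt H (dH r) r := by
  have h1 := ((hasDerivAt_inv hr).const_sub 1).const_mul 2
  have h2 : H = fun x : ℝ => 2 * (1 - x⁻¹) := by
    funext x
    simp [H]
  rw [h2]
  refine h1.congr_deriv ?_
  simp only [dH]
  ring

/-- The nonlocal boundary functional `B(lam, φ)` at the cathode. -/
def B (a b γ lam : ℝ) (φ : ℝ → ℝ) : ℝ :=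
  dr φ 2 + lam / 4 * φ 2
    - a * γ * (lam / 2) * Real.exp (-lam / 2) *
      ∫ r in (1 : ℝ)..2, Real.exp (-(b * r ^ 2) / (2 * lam)) * Real.exp (lam / r) * φ r

/-- The function `φ ∈ H²(I)` solves the electron system with parameters `a`, `b`, `γ`, `lam`. -/
structure IsElectronSolution (a b γ lam : ℝ) (φ : ℝ → ℝ) : Prop where
  memH2 : MemH2 φ
  eqn : NegRadialLaplacianEq φ (fun r => g a b (lam * dH r) * φ r)
  anode : φ 1 = 0
  pos : ∀ r ∈ Ioo (1 : ℝ) 2, 0 < φ r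
  cathode : B a b γ lam φ = 0

/-- The function `ψ ∈ H²(I)` solves the adjoint boundary value problem. -/
structure IsAdjointSolution (a b γ lam : ℝ) (ψ : ℝ → ℝ) : Prop where
  memH2 : MemH2 ψ
  eqn : NegRadialLaplacianEq ψ (fun r => g a b (lam * dH r) * ψ r
    + h a b (lam * dH r) * Real.exp (-(lam / 2) * H r) * γ * Real.exp (lam / 2) * ψ 2)
  anode : ψ 1 = 0
  cathode : dr ψ 2 + lam / 4 * ψ 2 = 0

/-- The voltages `lam > 0` for which the electron system has a (positive) solution. -/
def sparkingVoltages (a b γ : ℝ) : Set ℝ :=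
  {lam | 0 < lam ∧ ∃ φ : ℝ → ℝ, IsElectronSolution a b γ lam φ}

/-- The sparking parameter set: the triples `(a, b, γ)` of positive constants for which the electron
system is solvable for some voltage. -/
def sparkingParameterSet : Set (ℝ × ℝ × ℝ) :=
  {p | 0 < p.1 ∧ 0 < p.2.1 ∧ 0 < p.2.2 ∧ (sparkingVoltages p.1 p.2.1 p.2.2).Nonempty}

/-- The sparking voltage `λ†(a, b, γ)`, for `(a, b, γ)` in the sparking parameter set. -/
def sparkingVoltage (a b γ : ℝ) : ℝ := sInf (sparkingVoltages a b γ)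

/-- The transversality expression `F`, for a voltage `lam`, a solution `φ` of the electron system
and a solution `ψ` of the adjoint problem. -/
def F (a b γ lam : ℝ) (φ ψ : ℝ → ℝ) : ℝ :=
  -γ * Real.exp (lam / 2) *
      (∫ r in (1 : ℝ)..2, r ^ 2 * ψ 2 *
        (deriv (h a b) (lam * dH r) * dH r - h a b (lam * dH r) * (H r / 2)) *
          Real.exp (-(lam / 2) * H r) * φ r)
    - (∫ r in (1 : ℝ)..2, r ^ 2 * ψ r * deriv (g a b) (lam * dH r) * dH r * φ r)
    + ψ 2 * (φ 2 - 2 * dr φ 2 - lam / 2 * φ 2)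

/-- The transversality condition at the sparking voltage `λ†`: `λ†` is positive, the electron system
has a solution at `λ†`, the adjoint problem has a nontrivial solution at `λ†`, and `F ≠ 0` for every
such pair of solutions. (Both solution spaces are one-dimensional, so that `F ≠ 0` does not depend
on the choice of the pair.) -/
def TransversalityCondition (a b γ : ℝ) : Prop :=
  0 < sparkingVoltage a b γ ∧
  (∃ φ : ℝ → ℝ, IsElectronSolution a b γ (sparkingVoltage a b γ) φ) ∧
  (∃ ψ : ℝ → ℝ, IsAdjointSolution a b γ (sparkingVoltage a b γ) ψ ∧
    ∃ r ∈ Icc (1 : ℝ) 2, ψ r ≠ 0) ∧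
  ∀ φ ψ : ℝ → ℝ, IsElectronSolution a b γ (sparkingVoltage a b γ) φ →
    IsAdjointSolution a b γ (sparkingVoltage a b γ) ψ → (∃ r ∈ Icc (1 : ℝ) 2, ψ r ≠ 0) →
      F a b γ (sparkingVoltage a b γ) φ ψ ≠ 0

/-- The set `Γ` of the positive parameters `(a, b, γ)` with `γ > 1/a` and `b > (4/e) a`. -/
def Gam : Set (ℝ × ℝ × ℝ) :=
  {p | 0 < p.1 ∧ 0 < p.2.1 ∧ 0 < p.2.2 ∧ 1 / p.1 < p.2.2 ∧ 4 / Real.exp 1 * p.1 < p.2.1}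

end GasDischarge

end

/-! The nonlocal problem reduces to one scalar equation in the voltage. Put E = exp(lam/r - lam/2).
Then (r²E')' = lam²E/r², which matches the term -ℓ²/4 of `g`, so Green's formula for φ against E
turns the cathode integral into boundary values (`B_eq`). Let φ be the solution with φ(1) = 0, φ'(1)
= 1, and set τ = log lam and G(a,b,τ) = exp(-lam/2)(4φ'(2) + lam φ(2)). The cathode condition
becomes (1+γ)G = γ. On `Gam` the coefficient `g` is negative, so φ is automatically positive on
(1,2) and the sparking voltages are exactly the roots of this equation (`sparkingVoltages_eq`).

For existence, G ≥ 1 - 2a·lam at small voltage (`one_sub_le_G`), while `G_mul_le` gives, when G ≥ 0,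
G(1 + a exp(-2b/lam)(1 - 1/lam)) ≤ 1, with limiting bound 1/(1+a). The latter lies below γ/(1+γ)
exactly when aγ > 1. The intermediate value theorem yields a root; the first bound keeps roots away
from lam = 0, so a least root exists.

For transversality, adding γψ(2)E to an adjoint solution ψ removes its source term. Hence ψ =
c((1+γ)χ - γE) with χ a homogeneous solution fixed by its data at the cathode, and F becomes a
nonzero multiple of ∂G/∂τ (`F_eq_G'`). It remains that for almost every (a,b,γ) all roots are
simple. For fixed a, b the bad γ are critical values of τ ↦ G/(1-G), a null set by Sard's theorem;
Fubini's theorem concludes. -/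

noncomputable section

namespace GasDischarge

/-! ### Linear differential equations depending continuously on a parameter -/

section LinearODE

variable {P E : Type*} [NormedAddCommGroup E] [NormedSpace ℝ E]

/-- The terms of the Picard series of the linear equation `X' = A X`, with `X = x₀` at time `0`. -/
def picardTerm (A : P → ℝ → E →L[ℝ] E) (x₀ : P → E) : ℕ → P → ℝ → E
  | 0, p, _ => x₀ p
  | n + 1, p, t => t • ∫ σ in (0 : ℝ)..1, A p (σ * t) (picardTerm A x₀ n p (σ * t))

variable {A : P → ℝ → E →L[ℝ] E} {x₀ : P → E} {M : P → ℝ}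

/-- Rescaling the time integral to the fixed interval (0,1) makes joint continuity a statement about
parametric integrals with constant limits; `picardTerm_succ` recovers the usual iteration. -/
theorem continuous_picardTerm [TopologicalSpace P] (hA : Continuous (Function.uncurry A)) (hx : Continuous x₀) (n : ℕ) :
    Continuous (Function.uncurry (picardTerm A x₀ n)) := by
  induction n with
  | zero => exact hx.comp continuous_fst
  | succ n ih =>
    refine Continuous.smul continuous_snd ?_
    refine intervalIntegral.continuous_parametric_intervalIntegral_of_continuous'
      (f := fun (x : P × ℝ) σ => A x.1 (σ * x.2) (picardTerm A x₀ n x.1 (σ * x.2))) ?_ 0 1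
    have hm : Continuous fun y : (P × ℝ) × ℝ => (y.1.1, y.2 * y.1.2) := by fun_prop
    exact (hA.comp hm).clm_apply (ih.comp hm)

theorem picardTerm_succ (n : ℕ) (p : P) (t : ℝ) :
    picardTerm A x₀ (n + 1) p t = ∫ s in (0 : ℝ)..t, A p s (picardTerm A x₀ n p s) := by
  have := intervalIntegral.smul_integral_comp_mul_right (a := 0) (b := 1)
    (fun s => A p s (picardTerm A x₀ n p s)) t
  simpa [picardTerm] using this

theorem norm_picardTerm_le (hM : ∀ p t, ‖A p t‖ ≤ M p) (n : ℕ) (p : P) (t : ℝ) :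
    ‖picardTerm A x₀ n p t‖ ≤ ‖x₀ p‖ * ((M p * |t|) ^ n / n.factorial) := by
  have hM0 : 0 ≤ M p := (norm_nonneg _).trans (hM p 0)
  induction n generalizing t with
  | zero => simp [picardTerm]
  | succ n ih =>
    rw [picardTerm, norm_smul, Real.norm_eq_abs]
    have h1 : ‖∫ σ in (0 : ℝ)..1, A p (σ * t) (picardTerm A x₀ n p (σ * t))‖ ≤
        ∫ σ in (0 : ℝ)..1, M p * (‖x₀ p‖ * ((M p * |t|) ^ n / n.factorial)) * σ ^ n := by
      refine intervalIntegral.norm_integral_le_of_norm_le zero_le_one (ae_of_all _ ?_)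
        (by apply Continuous.intervalIntegrable; fun_prop)
      intro σ hσ
      refine ((A p (σ * t)).le_of_opNorm_le (hM p _) _).trans ?_
      refine (mul_le_mul_of_nonneg_left (ih (σ * t)) hM0).trans (le_of_eq ?_)
      rw [abs_mul, abs_of_pos hσ.1]
      ring
    refine (mul_le_mul_of_nonneg_left h1 (abs_nonneg t)).trans (le_of_eq ?_)
    rw [intervalIntegral.integral_const_mul, integral_pow, Nat.factorial_succ]
    push_cast
    field_simp
    simp [pow_succ]
    ring

/-- The factorial bound on the Picard terms is locally uniform in parameter and time because `M` and
`x₀` are continuous. The sum is therefore jointly continuous, and termwise integration gives the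
integral equation. -/
theorem exists_linear_ode_solution [TopologicalSpace P] [CompleteSpace E]
    (hA : Continuous (Function.uncurry A)) (hx : Continuous x₀)
    (hMc : Continuous M) (hM : ∀ p t, ‖A p t‖ ≤ M p) :
    ∃ X : P → ℝ → E, Continuous (Function.uncurry X) ∧ (∀ p, X p 0 = x₀ p) ∧
      ∀ p t, HasDerivAt (X p) (A p t (X p t)) t := by
  have hM0 : ∀ p, 0 ≤ M p := fun p => (norm_nonneg _).trans (hM p 0)
  have hsum : ∀ p t, Summable fun n => picardTerm A x₀ n p t := fun p t =>
    Summable.of_norm_bounded ((Real.summable_pow_div_factorial _).mul_left _)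
      fun n => norm_picardTerm_le hM n p t
  set X : P → ℝ → E := fun p t => ∑' n, picardTerm A x₀ n p t with hX
  have hXc : Continuous (Function.uncurry X) := by
    rw [continuous_iff_continuousAt]
    rintro ⟨p₀, t₀⟩
    have hU1 : IsOpen {y : P × ℝ | ‖x₀ y.1‖ < ‖x₀ p₀‖ + 1} :=
      isOpen_lt (hx.comp continuous_fst).norm continuous_const
    have hU2 : IsOpen {y : P × ℝ | M y.1 < M p₀ + 1} :=
      isOpen_lt (hMc.comp continuous_fst) continuous_const
    have hU3 : IsOpen {y : P × ℝ | |y.2| < |t₀| + 1} :=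
      isOpen_lt continuous_snd.abs continuous_const
    have hUm := (hU1.inter (hU2.inter hU3)).mem_nhds (x := (p₀, t₀)) (by simp)
    refine ContinuousOn.continuousAt ?_ hUm
    have hb : ∀ n, ∀ y ∈ {y : P × ℝ | ‖x₀ y.1‖ < ‖x₀ p₀‖ + 1} ∩
        ({y | M y.1 < M p₀ + 1} ∩ {y | |y.2| < |t₀| + 1}),
        ‖Function.uncurry (picardTerm A x₀ n) y‖ ≤
          (‖x₀ p₀‖ + 1) * (((M p₀ + 1) * (|t₀| + 1)) ^ n / n.factorial) := by
      rintro n ⟨p, t⟩ ⟨h1, h2, h3⟩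
      refine (norm_picardTerm_le hM n p t).trans ?_
      have h0 := hM0 p
      have h0' := hM0 p₀
      simp only [mem_ofPred_eq] at h1 h2 h3
      gcongr
    exact continuousOn_tsum (fun n => (continuous_picardTerm hA hx n).continuousOn)
      ((Real.summable_pow_div_factorial _).mul_left _) hb
  have hint : ∀ p t, X p t = x₀ p + ∫ s in (0 : ℝ)..t, A p s (X p s) := by
    intro p t
    have h1 : HasSum (fun n => ∫ s in (0 : ℝ)..t, A p s (picardTerm A x₀ n p s))
        (∫ s in (0 : ℝ)..t, A p s (X p s)) := by
      refine intervalIntegral.hasSum_integral_of_dominated_convergence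
        (bound := fun n _ => M p * (‖x₀ p‖ * ((M p * |t|) ^ n / n.factorial))) ?_ ?_ ?_ ?_ ?_
      · intro n
        have h2 : Continuous fun s => A p s (picardTerm A x₀ n p s) :=
          (hA.comp (Continuous.prodMk_right p)).clm_apply
            ((continuous_picardTerm hA hx n).comp (Continuous.prodMk_right p))
        exact h2.aestronglyMeasurable
      · refine fun n => ae_of_all _ fun s hs => ?_
        refine ((A p s).le_of_opNorm_le (hM p _) _).trans ?_
        have h3 : |s| ≤ |t| := by
          rcases le_total 0 t with h0 | h0
          · rw [uIoc_of_le h0] at hs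
            rw [abs_of_pos hs.1, abs_of_nonneg h0]; exact hs.2
          · rw [uIoc_of_ge h0] at hs
            rw [abs_of_nonpos hs.2, abs_of_nonpos h0]; linarith [hs.1]
        have := hM0 p
        refine mul_le_mul_of_nonneg_left ((norm_picardTerm_le hM n p s).trans ?_) this
        gcongr
      · exact ae_of_all _ fun s _ => ((Real.summable_pow_div_factorial _).mul_left _).mul_left _
      · exact intervalIntegrable_const
      · exact ae_of_all _ fun s _ => (A p s).hasSum (hsum p s).hasSum
    have h2 := (hsum p t).tsum_eq_zero_add
    simp only [picardTerm_succ, h1.tsum_eq] at h2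
    exact h2
  refine ⟨X, hXc, fun p => by rw [hint]; simp, fun p t => ?_⟩
  have hc : Continuous fun s => A p s (X p s) :=
    (hA.comp (Continuous.prodMk_right p)).clm_apply (hXc.comp (Continuous.prodMk_right p))
  have h1 := (intervalIntegral.integral_hasDerivAt_right (hc.intervalIntegrable 0 t)
    (hc.stronglyMeasurableAtFilter _ _) hc.continuousAt).const_add (x₀ p)
  exact h1.congr_of_eventuallyEq (Filter.Eventually.of_forall fun s => hint p s)

end LinearODE

/-- Joint continuity in the parameter and the variable, for the initial value problem of
`u'' = q u`. -/
theorem exists_secondOrder_solution {P : Type*} [TopologicalSpace P]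
    {q : P → ℝ → ℝ} {M α β : P → ℝ} (hq : Continuous (Function.uncurry q)) (hMc : Continuous M)
    (hM : ∀ p r, |q p r| ≤ M p) (hα : Continuous α) (hβ : Continuous β) (r₀ : ℝ) :
    ∃ u v : P → ℝ → ℝ, Continuous (Function.uncurry u) ∧ Continuous (Function.uncurry v) ∧
      (∀ p, u p r₀ = α p) ∧ (∀ p, v p r₀ = β p) ∧
      (∀ p r, HasDerivAt (u p) (v p r) r) ∧ ∀ p r, HasDerivAt (v p) (q p r * u p r) r := by
  -- The first-order system (u,v)' = (v, qu): `A₀` sends (x,y) to (y,0) and `A₁` sends it to (0,x).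
  -- Time is shifted so that `r₀` becomes 0.
  set A₀ : ℝ × ℝ →L[ℝ] ℝ × ℝ :=
    (ContinuousLinearMap.inl ℝ ℝ ℝ).comp (ContinuousLinearMap.snd ℝ ℝ ℝ)
  set A₁ : ℝ × ℝ →L[ℝ] ℝ × ℝ :=
    (ContinuousLinearMap.inr ℝ ℝ ℝ).comp (ContinuousLinearMap.fst ℝ ℝ ℝ)
  have hm : Continuous fun y : P × ℝ => (y.1, y.2 + r₀) := by fun_prop
  have hm' : Continuous fun y : P × ℝ => (y.1, y.2 - r₀) := by fun_prop
  obtain ⟨X, hXc, hX0, hX⟩ := exists_linear_ode_solution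
    (A := fun p t => A₀ + q p (t + r₀) • A₁) (x₀ := fun p => (α p, β p))
    (M := fun p => ‖A₀‖ + M p * ‖A₁‖)
    (continuous_const.add ((hq.comp hm).smul continuous_const)) (hα.prodMk hβ)
    (by fun_prop) (fun p t => by
      refine (norm_add_le _ _).trans ?_
      rw [norm_smul, Real.norm_eq_abs]
      gcongr
      exact hM _ _)
  have hd : ∀ p r, HasDerivAt (fun r => X p (r - r₀))
      ((X p (r - r₀)).2, q p r * (X p (r - r₀)).1) r := by
    intro p r
    have h1 := (hX p (r - r₀)).scomp r ((hasDerivAt_id r).sub_const r₀)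
    simpa [A₀, A₁, Function.comp_def] using h1
  refine ⟨fun p r => (X p (r - r₀)).1, fun p r => (X p (r - r₀)).2,
    (continuous_fst.comp hXc).comp hm', (continuous_snd.comp hXc).comp hm', fun p => by simp [hX0],
    fun p => by simp [hX0], fun p r => ?_, fun p r => ?_⟩
  · exact (hasFDerivAt_fst.comp_hasDerivAt r (hd p r))
  · exact (hasFDerivAt_snd.comp_hasDerivAt r (hd p r))

/-! ### Weak derivatives on (1,2) and regularity of H² functions -/

section WeakDerivative

theorem HasWeakDeriv.congr_ae {u v u' v' : ℝ → ℝ} (h : HasWeakDeriv u v)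
    (hu : u =ᵐ[volume.restrict (Ioo 1 2)] u') (hv : v =ᵐ[volume.restrict (Ioo 1 2)] v') :
    HasWeakDeriv u' v' := by
  have key : ∀ {f f' : ℝ → ℝ}, LocallyIntegrableOn f (Ioo 1 2) →
      f =ᵐ[volume.restrict (Ioo 1 2)] f' → LocallyIntegrableOn f' (Ioo 1 2) := by
    intro f f' hf hff'
    rw [locallyIntegrableOn_iff isOpen_Ioo.isLocallyClosed] at hf ⊢
    exact fun k hk hkc => (hf k hk hkc).congr_fun_ae (ae_restrict_of_ae_restrict_of_subset hk hff')
  refine ⟨key h.1 hu, key h.2.1 hv, fun η h1 h2 h3 => ?_⟩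
  have h4 := integral_congr_ae (hu.mul (Filter.EventuallyEq.refl _ (deriv η)))
  have h5 := integral_congr_ae (hv.mul (Filter.EventuallyEq.refl _ η))
  simp only [Pi.mul_apply] at h4 h5
  rw [← h4, ← h5]
  exact h.2.2 η h1 h2 h3

theorem eqOn_zero_of_tsupport_subset {η : ℝ → ℝ} (h : tsupport η ⊆ Ioo 1 2) :
    η 1 = 0 ∧ η 2 = 0 :=
  ⟨image_eq_zero_of_notMem_tsupport fun hx => lt_irrefl _ (h hx).1,
    image_eq_zero_of_notMem_tsupport fun hx => lt_irrefl _ (h hx).2⟩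

theorem _root_.MeasureTheory.LocallyIntegrableOn.integrableOn_mul_of_tsupport_subset
    {u θ : ℝ → ℝ} {s : Set ℝ} (hu : LocallyIntegrableOn u s) (hθ : Continuous θ)
    (hc : HasCompactSupport θ) (hs : tsupport θ ⊆ s) :
    IntegrableOn (fun r => u r * θ r) s := by
  have h1 : IntegrableOn (fun r => u r * θ r) (tsupport θ) :=
    (hu.integrableOn_compact_subset hs hc.isCompact).mul_continuousOn hθ.continuousOn hc.isCompact
  refine Integrable.integrableOn ((integrableOn_iff_integrable_of_support_subset ?_).1 h1)
  exact (Function.support_mul_subset_right u θ).trans (subset_tsupport θ)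

theorem setIntegral_Ioo_eq (f : ℝ → ℝ) :
    ∫ r in Ioo (1 : ℝ) 2, f r = ∫ r in (1 : ℝ)..2, f r := by
  rw [intervalIntegral.integral_of_le one_le_two, integral_Ioc_eq_integral_Ioo]

theorem hasWeakDeriv_of_hasDerivWithinAt {f f' : ℝ → ℝ}
    (hf : ∀ r ∈ Icc (1 : ℝ) 2, HasDerivWithinAt f (f' r) (Icc 1 2) r)
    (hf' : ContinuousOn f' (Icc 1 2)) : HasWeakDeriv f f' := by
  have hfc : ContinuousOn f (Icc 1 2) := fun r hr => (hf r hr).continuousWithinAt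
  refine ⟨(hfc.mono Ioo_subset_Icc_self).locallyIntegrableOn measurableSet_Ioo,
    (hf'.mono Ioo_subset_Icc_self).locallyIntegrableOn measurableSet_Ioo, fun η h1 _ h3 => ?_⟩
  have hη : ContDiff ℝ 1 η := h1.of_le (by exact_mod_cast le_top)
  rw [setIntegral_Ioo_eq, setIntegral_Ioo_eq]
  have h := intervalIntegral.integral_mul_deriv_eq_deriv_mul_of_hasDerivWithinAt
    (u := f) (u' := f') (v := η) (v' := deriv η) (a := 1) (b := 2)
    (by rwa [uIcc_of_le one_le_two])
    (fun x _ => ((hη.differentiable one_ne_zero) x).hasDerivAt.hasDerivWithinAt)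
    (ContinuousOn.intervalIntegrable (by rwa [uIcc_of_le one_le_two]))
    ((hη.continuous_deriv le_rfl).intervalIntegrable _ _)
  obtain ⟨h4, h5⟩ := eqOn_zero_of_tsupport_subset h3
  rw [h, h4, h5]
  ring

/-- The primitive from 1 vanishes to the left of the support of θ, and to the right of it because θ
has mean zero. -/
theorem exists_primitive_of_integral_eq_zero {θ : ℝ → ℝ} (hθ : ContDiff ℝ ∞ θ)
    (hs : HasCompactSupport θ) (hsub : tsupport θ ⊆ Ioo 1 2) (h0 : ∫ r in (1 : ℝ)..2, θ r = 0) :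
    ∃ ζ : ℝ → ℝ, ContDiff ℝ ∞ ζ ∧ HasCompactSupport ζ ∧ tsupport ζ ⊆ Ioo 1 2 ∧ deriv ζ = θ := by
  obtain ⟨α, β, hα, hβ, hsub'⟩ : ∃ α β : ℝ, 1 < α ∧ β < 2 ∧ tsupport θ ⊆ Icc α β := by
    rcases (tsupport θ).eq_empty_or_nonempty with he | hne
    -- With empty support any empty interval serves; [3,1] also meets the two strict bounds.
    · exact ⟨3, 1, by norm_num, by norm_num, by simp [he]⟩
    · obtain ⟨α, hα⟩ := hs.isCompact.exists_isLeast hne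
      obtain ⟨β, hβ⟩ := hs.isCompact.exists_isGreatest hne
      exact ⟨α, β, (hsub hα.1).1, (hsub hβ.1).2, fun x hx => ⟨hα.2 hx, hβ.2 hx⟩⟩
  have hz : ∀ x, x ∉ Icc α β → θ x = 0 := fun x hx =>
    image_eq_zero_of_notMem_tsupport fun h => hx (hsub' h)
  have hd : ∀ x, HasDerivAt (fun x => ∫ r in (1 : ℝ)..x, θ r) (θ x) x := fun x =>
    intervalIntegral.integral_hasDerivAt_right (hθ.continuous.intervalIntegrable _ _)
      (hθ.continuous.stronglyMeasurableAtFilter _ _) hθ.continuous.continuousAt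
  have hd' : deriv (fun x => ∫ r in (1 : ℝ)..x, θ r) = θ := funext fun x => (hd x).deriv
  have hsupp : Function.support (fun x => ∫ r in (1 : ℝ)..x, θ r) ⊆ Icc α β := by
    intro x hx
    by_contra hxn
    apply hx
    rw [mem_Icc, not_and_or, not_le, not_le] at hxn
    rcases hxn with h | h
    · refine (intervalIntegral.integral_congr (g := fun _ => 0) fun r hr => ?_).trans (by simp)
      refine hz r fun hr' => ?_
      have := hr.2
      rcases max_choice (1 : ℝ) x with h1 | h1 <;> rw [h1] at this <;> linarith [hr'.1]
    · have h1 : ∫ r in x..(2 : ℝ), θ r = 0 := by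
        refine (intervalIntegral.integral_congr (g := fun _ => 0) fun r hr => ?_).trans (by simp)
        refine hz r fun hr' => ?_
        have := hr.1
        rcases min_choice x (2 : ℝ) with h1 | h1 <;> rw [h1] at this <;> linarith [hr'.2]
      have h2 := intervalIntegral.integral_add_adjacent_intervals
        (hθ.continuous.intervalIntegrable (μ := volume) 1 x) (hθ.continuous.intervalIntegrable x 2)
      simp only
      linarith
  have hts : tsupport (fun x => ∫ r in (1 : ℝ)..x, θ r) ⊆ Icc α β :=
    closure_minimal hsupp isClosed_Icc
  refine ⟨_, ?_, HasCompactSupport.of_support_subset_isCompact isCompact_Icc hsupp,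
    hts.trans fun x hx => ⟨hα.trans_le hx.1, hx.2.trans_lt hβ⟩, hd'⟩
  rw [contDiff_infty_iff_deriv, hd']
  exact ⟨fun x => (hd x).differentiableAt, hθ⟩

/-- The lemma of du Bois-Reymond. -/
theorem ae_eq_const_of_hasWeakDeriv_zero {w : ℝ → ℝ} (hw : HasWeakDeriv w fun _ => 0) :
    ∃ c, ∀ᵐ r, r ∈ Ioo (1 : ℝ) 2 → w r = c := by
  -- A fixed bump of positive mass: subtracting the right multiple of it from a test function leaves
  -- mean zero, hence a derivative of a test function. The constant is then the average of `w`
  -- weighted by the bump.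
  obtain ⟨f, hft, hfc, hfd, hfr, hf1⟩ := exists_contDiff_tsupport_subset (n := ⊤)
    (isOpen_Ioo.mem_nhds (show (3 / 2 : ℝ) ∈ Ioo (1 : ℝ) 2 by norm_num))
  have hf0 : 0 < ∫ r in (1 : ℝ)..2, f r :=
    intervalIntegral.integral_pos one_lt_two hfd.continuous.continuousOn
      (fun x _ => (hfr (mem_range_self x)).1) ⟨3 / 2, by norm_num, by rw [hf1]; norm_num⟩
  set I := ∫ r in (1 : ℝ)..2, f r
  have hwf := hw.1.integrableOn_mul_of_tsupport_subset hfd.continuous hfc hft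
  set c := (∫ r in Ioo (1 : ℝ) 2, w r * f r) / I with hc
  refine ⟨c, ?_⟩
  have hwc : LocallyIntegrableOn (fun r => w r - c) (Ioo 1 2) :=
    hw.1.sub (continuous_const.locallyIntegrable.locallyIntegrableOn _)
  have h0 : ∀ η : ℝ → ℝ, ContDiff ℝ ∞ η → HasCompactSupport η → tsupport η ⊆ Ioo 1 2 →
      ∫ x, η x • (w x - c) = 0 := by
    intro η h1 h2 h3
    set J := ∫ r in (1 : ℝ)..2, η r with hJ
    have hsub : tsupport (fun r => η r - J / I * f r) ⊆ tsupport η ∪ tsupport f := by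
      refine closure_minimal (fun x hx => ?_)
        ((isClosed_tsupport _).union (isClosed_tsupport _))
      by_contra hn
      rw [mem_union, not_or] at hn
      exact hx (by simp [image_eq_zero_of_notMem_tsupport hn.1,
        image_eq_zero_of_notMem_tsupport hn.2])
    obtain ⟨ζ, hζ1, hζ2, hζ3, hζ4⟩ := exists_primitive_of_integral_eq_zero
      (θ := fun r => η r - J / I * f r) (h1.sub (contDiff_const.mul hfd))
      (HasCompactSupport.of_support_subset_isCompact (h2.isCompact.union hfc.isCompact)
        ((subset_tsupport _).trans hsub)) (hsub.trans (union_subset h3 hft)) (by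
        rw [intervalIntegral.integral_sub (h1.continuous.intervalIntegrable _ _)
          ((hfd.continuous.intervalIntegrable _ _).const_mul _),
          intervalIntegral.integral_const_mul]
        field_simp
        simp [I, hJ])
    have hwη := hw.1.integrableOn_mul_of_tsupport_subset h1.continuous h2 h3
    have h4 := hw.2.2 ζ hζ1 hζ2 hζ3
    simp only [hζ4, zero_mul, integral_zero, neg_zero] at h4
    have h5 : ∀ r, w r * (η r - J / I * f r) = w r * η r - J / I * (w r * f r) := fun r => by ring
    simp only [h5] at h4
    rw [integral_sub hwη (hwf.const_mul _), integral_const_mul] at h4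
    have h6 : ∫ x, η x • (w x - c) = ∫ x in Ioo (1 : ℝ) 2, η x • (w x - c) := by
      refine (setIntegral_eq_integral_of_forall_compl_eq_zero fun x hx => ?_).symm
      rw [image_eq_zero_of_notMem_tsupport fun h => hx (h3 h), zero_smul]
    have h7 : ∀ r, η r • (w r - c) = w r * η r - c * η r := fun r => by simp; ring
    rw [h6]
    simp only [h7]
    rw [integral_sub hwη (((h1.continuous.integrableOn_Icc (a := 1) (b := 2)).mono_set
      Ioo_subset_Icc_self).const_mul _), integral_const_mul, setIntegral_Ioo_eq η, ← hJ, hc]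
    rw [← h4]
    ring
  filter_upwards [isOpen_Ioo.ae_eq_zero_of_integral_contDiff_smul_eq_zero hwc h0] with r hr hr'
  linarith [hr hr']

/-- If the weak derivative `v` of `u` is integrable, then `u` is a primitive of `v`. -/
theorem HasWeakDeriv.eq_primitive {u v : ℝ → ℝ} (h : HasWeakDeriv u v)
    (hv : IntegrableOn v (Ioo 1 2)) :
    ∃ c, ∀ᵐ r, r ∈ Ioo (1 : ℝ) 2 → u r = c + ∫ s in (1 : ℝ)..r, v s := by
  have hvi : IntervalIntegrable v volume 1 2 := by
    rwa [intervalIntegrable_iff_integrableOn_Ioo_of_le one_le_two]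
  set V : ℝ → ℝ := fun r => ∫ s in (1 : ℝ)..r, v s with hV
  have hac : AbsolutelyContinuousOnInterval V 1 2 :=
    hvi.absolutelyContinuousOnInterval_intervalIntegral (by simp)
  have hVc : ContinuousOn V (Icc 1 2) := by
    simpa [uIcc_of_le (one_le_two (α := ℝ))] using hac.continuousOn
  have hVl : LocallyIntegrableOn V (Ioo 1 2) :=
    (hVc.mono Ioo_subset_Icc_self).locallyIntegrableOn measurableSet_Ioo
  have hVd : ∀ᵐ x, x ∈ uIoc (1 : ℝ) 2 → deriv V x = v x := by
    filter_upwards [hvi.ae_hasDerivAt_integral] with x hx hx'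
    exact (hx (uIoc_subset_uIcc hx') 1 (by simp)).deriv
  -- The primitive `V` is only absolutely continuous; integration by parts in that class shows that
  -- u - V has weak derivative zero.
  obtain ⟨c, hc⟩ := ae_eq_const_of_hasWeakDeriv_zero (w := fun r => u r - V r)
    ⟨h.1.sub hVl, locallyIntegrableOn_zero, fun η h1 h2 h3 => by
      have hη : ContDiff ℝ 1 η := h1.of_le (by exact_mod_cast le_top)
      have h4 := h.2.2 η h1 h2 h3
      have h5 : AbsolutelyContinuousOnInterval η 1 2 :=
        hη.contDiffOn.absolutelyContinuousOnInterval
      have h6 := hac.integral_mul_deriv_eq_deriv_mul h5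
      obtain ⟨h7, h8⟩ := eqOn_zero_of_tsupport_subset h3
      have h9 : ∫ x in (1 : ℝ)..2, deriv V x * η x = ∫ x in (1 : ℝ)..2, v x * η x := by
        refine intervalIntegral.integral_congr_ae ?_
        filter_upwards [hVd] with x hx hx'
        rw [hx hx']
      have hdc : Continuous (deriv η) := hη.continuous_deriv le_rfl
      have hi1 : IntegrableOn (fun r => u r * deriv η r) (Ioo 1 2) :=
        h.1.integrableOn_mul_of_tsupport_subset hdc h2.deriv
          ((closure_mono support_deriv_subset).trans (by rwa [tsupport, closure_closure] at *))
      have hi2 : IntegrableOn (fun r => V r * deriv η r) (Ioo 1 2) :=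
        ((hVc.mul hdc.continuousOn).integrableOn_Icc).mono_set Ioo_subset_Icc_self
      simp only [sub_mul]
      rw [integral_sub hi1 hi2, h4, setIntegral_Ioo_eq, setIntegral_Ioo_eq, h6, h9, h7, h8]
      simp⟩
  refine ⟨c, ?_⟩
  filter_upwards [hc] with r hr hr'
  linarith [hr hr']

theorem HasWeakDeriv.eq_primitive_of_continuousOn {u v : ℝ → ℝ} (h : HasWeakDeriv u v)
    (hv : IntegrableOn v (Ioo 1 2)) (hu : ContinuousOn u (Icc 1 2)) :
    ∀ r ∈ Icc (1 : ℝ) 2, u r = u 1 + ∫ s in (1 : ℝ)..r, v s := by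
  obtain ⟨c, hc⟩ := h.eq_primitive hv
  have hvi : IntervalIntegrable v volume 1 2 := by
    rwa [intervalIntegrable_iff_integrableOn_Ioo_of_le one_le_two]
  have hVc : ContinuousOn (fun r => c + ∫ s in (1 : ℝ)..r, v s) (Icc 1 2) := by
    have := (hvi.absolutelyContinuousOnInterval_intervalIntegral (c := 1) (by simp)).continuousOn
    rw [uIcc_of_le (one_le_two (α := ℝ))] at this
    exact continuousOn_const.add this
  have hIoo : EqOn u (fun r => c + ∫ s in (1 : ℝ)..r, v s) (Ioo 1 2) :=
    Measure.eqOn_Ioo_of_ae_eq volume ((ae_restrict_iff' measurableSet_Ioo).2 hc)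
      (hu.mono Ioo_subset_Icc_self) (hVc.mono Ioo_subset_Icc_self)
  have hIcc : EqOn u (fun r => c + ∫ s in (1 : ℝ)..r, v s) (Icc 1 2) :=
    hIoo.of_subset_closure hu hVc Ioo_subset_Icc_self (by rw [closure_Ioo (by norm_num)])
  intro r hr
  have h1 := hIcc (left_mem_Icc.2 one_le_two)
  simp only [intervalIntegral.integral_same, add_zero] at h1
  rw [h1]
  exact hIcc hr

theorem HasWeakDeriv.hasDerivWithinAt {u v v' : ℝ → ℝ} (h : HasWeakDeriv u v)
    (hu : ContinuousOn u (Icc 1 2)) (hv' : ContinuousOn v' (Icc 1 2))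
    (hvv' : ∀ᵐ r, r ∈ Ioo (1 : ℝ) 2 → v r = v' r) :
    ∀ r ∈ Icc (1 : ℝ) 2, HasDerivWithinAt u (v' r) (Icc 1 2) r := by
  have h' : HasWeakDeriv u v' :=
    h.congr_ae (Filter.EventuallyEq.refl _ _) ((ae_restrict_iff' measurableSet_Ioo).2 hvv')
  have h1 := h'.eq_primitive_of_continuousOn (hv'.integrableOn_Icc.mono_set Ioo_subset_Icc_self) hu
  intro r hr
  have hvi : IntervalIntegrable v' volume 1 r := ContinuousOn.intervalIntegrable
    (by rw [uIcc_of_le hr.1]; exact hv'.mono (Icc_subset_Icc_right hr.2))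
  have : Fact (r ∈ Icc (1 : ℝ) 2) := ⟨hr⟩
  have h2 : HasDerivWithinAt (fun x => ∫ s in (1 : ℝ)..x, v' s) (v' r) (Icc 1 2) r :=
    intervalIntegral.integral_hasDerivWithinAt_right hvi
      (hv'.stronglyMeasurableAtFilter_nhdsWithin measurableSet_Icc r) (hv' r hr)
  exact (h2.const_add (u 1)).congr (fun x hx => h1 x hx) (h1 r hr)

/-- The first weak derivative agrees almost everywhere with a primitive of the second, which is
continuous, so `u` is C¹ up to the end points and `dr` is its true derivative. -/
theorem MemH2.exists_hasDerivWithinAt {u : ℝ → ℝ} (h : MemH2 u) :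
    ContinuousOn (dr u) (Icc 1 2) ∧
      ∀ r ∈ Icc (1 : ℝ) 2, HasDerivWithinAt u (dr u r) (Icc 1 2) r := by
  obtain ⟨hc, u₁, u₂, h1, h2, -, -, h3⟩ := h
  have hi : IntegrableOn u₂ (Ioo 1 2) := h3.integrable (by norm_num)
  have hi' : IntervalIntegrable u₂ volume 1 2 := by
    rwa [intervalIntegrable_iff_integrableOn_Ioo_of_le one_le_two]
  obtain ⟨c, hcc⟩ := h2.eq_primitive hi
  have hVc : ContinuousOn (fun r => c + ∫ s in (1 : ℝ)..r, u₂ s) (Icc 1 2) := by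
    have := (hi'.absolutelyContinuousOnInterval_intervalIntegral (c := 1) (by simp)).continuousOn
    rw [uIcc_of_le (one_le_two (α := ℝ))] at this
    exact continuousOn_const.add this
  have hd := h1.hasDerivWithinAt hc hVc hcc
  have heq : EqOn (dr u) (fun r => c + ∫ s in (1 : ℝ)..r, u₂ s) (Icc 1 2) := fun r hr =>
    (hd r hr).derivWithin (uniqueDiffOn_Icc one_lt_two r hr)
  exact ⟨hVc.congr heq, fun r hr => by rw [heq hr]; exact hd r hr⟩

end WeakDerivative

/-! ### Classical radial equations: Green's formula and uniqueness -/

section ClassicalSolutions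

/-- `f` is continuously differentiable on `[1,2]` with derivative `f'`, and `(r² f')' = m` there. -/
structure RadialEq (f f' m : ℝ → ℝ) : Prop where
  hasDeriv : ∀ r ∈ Icc (1 : ℝ) 2, HasDerivWithinAt f (f' r) (Icc 1 2) r
  hasDeriv_flux : ∀ r ∈ Icc (1 : ℝ) 2, HasDerivWithinAt (fun r => r ^ 2 * f' r) (m r) (Icc 1 2) r
  cont : ContinuousOn m (Icc 1 2)

namespace RadialEq

variable {f f' m k k' n : ℝ → ℝ}

theorem continuousOn (hf : RadialEq f f' m) : ContinuousOn f (Icc 1 2) :=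
  fun r hr => (hf.hasDeriv r hr).continuousWithinAt

theorem hasDerivWithinAt_deriv (hf : RadialEq f f' m) {r : ℝ} (hr : r ∈ Icc (1 : ℝ) 2) :
    HasDerivWithinAt f' (m r / r ^ 2 - 2 * f' r / r) (Icc 1 2) r := by
  have hr0 : r ≠ 0 := by linarith [hr.1]
  have h1 := (hf.hasDeriv_flux r hr).div ((hasDerivAt_pow 2 r).hasDerivWithinAt (s := Icc 1 2))
    (pow_ne_zero 2 hr0)
  refine (h1.congr (fun x hx => ?_) ?_).congr_deriv ?_
  · have hx0 : x ≠ 0 := by linarith [hx.1]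
    simp only [Pi.div_apply]
    field_simp
  · simp only [Pi.div_apply]
    field_simp
  · field_simp
    push_cast
    ring

theorem continuousOn_deriv (hf : RadialEq f f' m) : ContinuousOn f' (Icc 1 2) :=
  fun _ hr => (hf.hasDerivWithinAt_deriv hr).continuousWithinAt

theorem dr_eq (hf : RadialEq f f' m) {r : ℝ} (hr : r ∈ Icc (1 : ℝ) 2) : dr f r = f' r :=
  (hf.hasDeriv r hr).derivWithin (uniqueDiffOn_Icc one_lt_two r hr)

theorem congr (hf : RadialEq f f' m) (hk : EqOn k f (Icc 1 2)) (hk' : EqOn k' f' (Icc 1 2))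
    (hn : EqOn n m (Icc 1 2)) : RadialEq k k' n where
  hasDeriv r hr := by
    rw [hk' hr]
    exact (hf.hasDeriv r hr).congr hk (hk hr)
  hasDeriv_flux r hr := by
    rw [hn hr]
    exact (hf.hasDeriv_flux r hr).congr (fun x hx => by simp only [hk' hx]) (by simp only [hk' hr])
  cont := hf.cont.congr hn

theorem add (hf : RadialEq f f' m) (hk : RadialEq k k' n) :
    RadialEq (fun r => f r + k r) (fun r => f' r + k' r) (fun r => m r + n r) where
  hasDeriv r hr := (hf.hasDeriv r hr).add (hk.hasDeriv r hr)
  hasDeriv_flux r hr := ((hf.hasDeriv_flux r hr).add (hk.hasDeriv_flux r hr)).congr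
    (fun x _ => by simp; ring) (by simp; ring)
  cont := hf.cont.add hk.cont

theorem const_mul (hf : RadialEq f f' m) (c : ℝ) :
    RadialEq (fun r => c * f r) (fun r => c * f' r) (fun r => c * m r) where
  hasDeriv r hr := (hf.hasDeriv r hr).const_mul c
  hasDeriv_flux r hr := ((hf.hasDeriv_flux r hr).const_mul c).congr
    (fun x _ => by ring) (by ring)
  cont := continuousOn_const.mul hf.cont

/-- The integrand is the derivative of r²(f'k - fk'); the factor 4 is r² at the cathode. -/
theorem integral_green (hf : RadialEq f f' m) (hk : RadialEq k k' n) :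
    ∫ r in (1 : ℝ)..2, (m r * k r - f r * n r) =
      4 * (f' 2 * k 2 - f 2 * k' 2) - (f' 1 * k 1 - f 1 * k' 1) := by
  have hd : ∀ r ∈ Icc (1 : ℝ) 2,
      HasDerivWithinAt (fun r => r ^ 2 * f' r * k r - f r * (r ^ 2 * k' r))
        (m r * k r - f r * n r) (Icc 1 2) r := fun r hr =>
    (((hf.hasDeriv_flux r hr).mul (hk.hasDeriv r hr)).sub
      ((hf.hasDeriv r hr).mul (hk.hasDeriv_flux r hr))).congr_deriv (by ring)
  have hc : ContinuousOn (fun r => m r * k r - f r * n r) (Icc 1 2) :=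
    (hf.cont.mul hk.continuousOn).sub (hf.continuousOn.mul hk.cont)
  rw [intervalIntegral.integral_eq_sub_of_hasDerivAt_of_le one_le_two
    (fun r hr => (hd r hr).continuousWithinAt)
    (fun r hr => (hd r (Ioo_subset_Icc_self hr)).hasDerivAt (Icc_mem_nhds hr.1 hr.2))
    (hc.intervalIntegrable_of_Icc one_le_two)]
  ring

theorem memH2 (hf : RadialEq f f' m) : MemH2 f := by
  have hm : ContinuousOn (fun r => m r / r ^ 2 - 2 * f' r / r) (Icc 1 2) := by
    have h0 : ∀ r ∈ Icc (1 : ℝ) 2, r ≠ 0 := fun r hr => by linarith [hr.1]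
    exact (hf.cont.div (by fun_prop) fun r hr => pow_ne_zero 2 (h0 r hr)).sub
      ((continuousOn_const.mul hf.continuousOn_deriv).div continuousOn_id h0)
  have key : ∀ {w : ℝ → ℝ}, ContinuousOn w (Icc 1 2) → MemLp w 2 (volume.restrict (Ioo 1 2)) := by
    intro w hw
    obtain ⟨C, hC⟩ := isCompact_Icc.exists_bound_of_continuousOn hw
    exact MemLp.of_bound ((hw.mono Ioo_subset_Icc_self).aestronglyMeasurable measurableSet_Ioo) C
      ((ae_restrict_iff' measurableSet_Ioo).2 (ae_of_all _ fun r hr => hC r (Ioo_subset_Icc_self hr)))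
  exact ⟨hf.continuousOn, f', _, hasWeakDeriv_of_hasDerivWithinAt hf.hasDeriv hf.continuousOn_deriv,
    hasWeakDeriv_of_hasDerivWithinAt (fun r hr => hf.hasDerivWithinAt_deriv hr) hm,
    key hf.continuousOn, key hf.continuousOn_deriv, key hm⟩

theorem negRadialLaplacianEq (hf : RadialEq f f' fun r => -(r ^ 2 * m r)) :
    NegRadialLaplacianEq f m := by
  refine ⟨_, (hasWeakDeriv_of_hasDerivWithinAt hf.hasDeriv_flux hf.cont).congr_ae
    ((ae_restrict_iff' measurableSet_Ioo).2 (ae_of_all _ fun r hr => ?_))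
    (Filter.EventuallyEq.refl _ _),
    (ae_restrict_iff' measurableSet_Ioo).2 (ae_of_all _ fun r hr => ?_)⟩
  · simp only [hf.dr_eq (Ioo_subset_Icc_self hr)]
  · have : r ≠ 0 := by linarith [hr.1]
    field_simp

end RadialEq

/-- With a continuous right-hand side the flux r²f' is C¹, so the weak equation is classical and
everything below can be done with ordinary derivatives. -/
theorem NegRadialLaplacianEq.radialEq {f m : ℝ → ℝ} (h : NegRadialLaplacianEq f m) (hf : MemH2 f)
    (hm : ContinuousOn m (Icc 1 2)) : RadialEq f (dr f) fun r => -(r ^ 2 * m r) := by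
  obtain ⟨h1, h2⟩ := hf.exists_hasDerivWithinAt
  obtain ⟨q, hq, hqm⟩ := h
  have hc : ContinuousOn (fun r => -(r ^ 2 * m r)) (Icc 1 2) :=
    ((continuousOn_pow 2).mul hm).neg
  refine ⟨h2, hq.hasDerivWithinAt ((continuousOn_pow 2).mul h1) hc ?_, hc⟩
  filter_upwards [(ae_restrict_iff' measurableSet_Ioo).1 hqm] with r hr hr'
  have : r ≠ 0 := by linarith [hr'.1]
  rw [← hr hr']
  field_simp

/-- The pair (f, r²f') solves a first-order system, Lipschitz with constant max(1, sup|w|). Data at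
1 identify electron solutions, data at 2 adjoint solutions. -/
theorem RadialEq.eqOn_zero {f f' w : ℝ → ℝ} (hf : RadialEq f f' fun r => w r * f r)
    (hw : ContinuousOn w (Icc 1 2))
    (h : (f 1 = 0 ∧ f' 1 = 0) ∨ (f 2 = 0 ∧ f' 2 = 0)) : EqOn f 0 (Icc 1 2) := by
  obtain ⟨C, hC⟩ := isCompact_Icc.exists_bound_of_continuousOn hw
  set V : ℝ → ℝ × ℝ → ℝ × ℝ := fun t x => (x.2 / t ^ 2, w t * x.1) with hV
  have hLip : ∀ t ∈ Icc (1 : ℝ) 2, LipschitzOnWith (max 1 C.toNNReal) (V t) univ := by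
    intro t ht
    refine LipschitzOnWith.of_dist_le_mul fun x _ y _ => ?_
    have hM : (0 : ℝ) ≤ max 1 C.toNNReal := by positivity
    rw [Prod.dist_eq]
    refine max_le ?_ ?_
    · have h1 : dist x.2 y.2 ≤ dist x y := le_max_right _ _
      have h2 : (1 : ℝ) ≤ ((max 1 C.toNNReal : NNReal) : ℝ) := by exact_mod_cast le_max_left _ _
      simp only [hV, Real.dist_eq] at h1 ⊢
      rw [← sub_div, abs_div, abs_of_pos (by have := ht.1; positivity : (0 : ℝ) < t ^ 2)]
      calc |x.2 - y.2| / t ^ 2 ≤ |x.2 - y.2| := div_le_self (abs_nonneg _) (one_le_pow₀ ht.1)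
        _ ≤ 1 * dist x y := by rw [one_mul]; exact h1
        _ ≤ _ := by gcongr
    · have h1 : dist x.1 y.1 ≤ dist x y := le_max_left _ _
      have h2 : C ≤ ((max 1 C.toNNReal : NNReal) : ℝ) :=
        (Real.le_coe_toNNReal C).trans (by exact_mod_cast le_max_right _ _)
      simp only [hV, Real.dist_eq] at h1 ⊢
      rw [← mul_sub, abs_mul]
      have h3 : |w t| ≤ ((max 1 C.toNNReal : NNReal) : ℝ) := (hC t ht).trans h2
      gcongr
  have hXd : ∀ r ∈ Icc (1 : ℝ) 2, HasDerivWithinAt (fun r => (f r, r ^ 2 * f' r))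
      (V r (f r, r ^ 2 * f' r)) (Icc 1 2) r := by
    intro r hr
    have hr0 : r ≠ 0 := by linarith [hr.1]
    refine ((hf.hasDeriv r hr).prodMk (hf.hasDeriv_flux r hr)).congr_deriv ?_
    simp [hV, hr0]
  have hXc : ContinuousOn (fun r => (f r, r ^ 2 * f' r)) (Icc 1 2) := fun r hr =>
    (hXd r hr).continuousWithinAt
  have h0 : ∀ r : ℝ, V r (0, 0) = 0 := fun r => by simp [hV]
  have hzd : ∀ (s : Set ℝ) (r : ℝ),
      HasDerivWithinAt (fun _ : ℝ => ((0 : ℝ), (0 : ℝ))) (V r (0, 0)) s r := fun s r => by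
    rw [h0]; exact hasDerivWithinAt_const _ _ _
  have key : EqOn (fun r => (f r, r ^ 2 * f' r)) (fun _ => ((0 : ℝ), (0 : ℝ))) (Icc 1 2) := by
    rcases h with ⟨h1, h2⟩ | ⟨h1, h2⟩
    · exact ODE_solution_unique_of_mem_Icc_right
        (fun t ht => hLip t (Ico_subset_Icc_self ht)) hXc
        (fun t ht => (hXd t (Ico_subset_Icc_self ht)).mono_of_mem_nhdsWithin
          (Icc_mem_nhdsGE_of_mem ht)) (fun _ _ => mem_univ _) continuousOn_const
        (fun t _ => hzd _ t) (fun _ _ => mem_univ _) (by simp [h1, h2])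
    · exact ODE_solution_unique_of_mem_Icc_left
        (fun t ht => hLip t (Ioc_subset_Icc_self ht)) hXc
        (fun t ht => (hXd t (Ioc_subset_Icc_self ht)).mono_of_mem_nhdsWithin
          (Icc_mem_nhdsLE_of_mem ht)) (fun _ _ => mem_univ _) continuousOn_const
        (fun t _ => hzd _ t) (fun _ _ => mem_univ _) (by simp [h1, h2])
  exact fun r hr => congrArg Prod.fst (key hr)

end ClassicalSolutions

/-! ### The ionization coefficients and the sign of g -/

section Coefficients

theorem dH_pos {r : ℝ} (hr : r ∈ Icc (1 : ℝ) 2) : 0 < dH r := by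
  have := hr.1
  unfold dH
  positivity

theorem hasDerivAt_h (a b : ℝ) {l : ℝ} (hl : l ≠ 0) :
    HasDerivAt (h a b) (a * Real.exp (-b / l) * (1 + b / l)) l := by
  have h1 : HasDerivAt (fun l : ℝ => -b / l) (b / l ^ 2) l :=
    ((hasDerivAt_const l (-b)).div (hasDerivAt_id l) hl).congr_deriv (by simp)
  refine (((hasDerivAt_id l).const_mul a).mul h1.exp).congr_deriv ?_
  simp only [id]
  field_simp

theorem hasDerivAt_g (a b : ℝ) {l : ℝ} (hl : l ≠ 0) :
    HasDerivAt (g a b) (deriv (h a b) l - l / 2) l := by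
  refine ((hasDerivAt_h a b hl).sub ((hasDerivAt_pow 2 l).div_const 4)).congr_deriv ?_
  rw [(hasDerivAt_h a b hl).deriv]
  push_cast
  ring

theorem continuousOn_h_comp (a b : ℝ) {lam : ℝ} (hl : 0 < lam) :
    ContinuousOn (fun r => h a b (lam * dH r)) (Icc 1 2) := by
  intro r hr
  have h1 : ContinuousAt dH r := by
    unfold dH
    have : r ^ 2 ≠ 0 := by have := hr.1; positivity
    fun_prop (disch := assumption)
  exact ((hasDerivAt_h a b (mul_pos hl (dH_pos hr)).ne').continuousAt.comp
    (f := fun r => lam * dH r) (continuousAt_const.mul h1)).continuousWithinAt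

theorem continuousOn_g_comp (a b : ℝ) {lam : ℝ} (hl : 0 < lam) :
    ContinuousOn (fun r => g a b (lam * dH r)) (Icc 1 2) := by
  intro r hr
  have h1 : ContinuousAt dH r := by
    unfold dH
    have : r ^ 2 ≠ 0 := by have := hr.1; positivity
    fun_prop (disch := assumption)
  exact ((hasDerivAt_g a b (mul_pos hl (dH_pos hr)).ne').continuousAt.comp
    (f := fun r => lam * dH r) (continuousAt_const.mul h1)).continuousWithinAt

theorem h_comp (a b lam : ℝ) {r : ℝ} (hr : r ≠ 0) :
    h a b (lam * dH r) = 2 * a * lam / r ^ 2 * Real.exp (-(b * r ^ 2) / (2 * lam)) := by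
  unfold h dH
  have : -b / (lam * (2 / r ^ 2)) = -(b * r ^ 2) / (2 * lam) := by
    rcases eq_or_ne lam 0 with rfl | h0
    · simp
    · field_simp
  rw [this]
  ring

theorem g_comp (a b lam : ℝ) {r : ℝ} (hr : r ≠ 0) :
    g a b (lam * dH r) = h a b (lam * dH r) - lam ^ 2 / r ^ 4 := by
  unfold g dH
  field_simp
  ring

/-- From x ≤ exp(x - 1) at x = b/l one gets a·exp(-b/l) ≤ al/(eb), and this is below l/4 exactly
when b > 4a/e. -/
theorem g_neg {a b l : ℝ} (ha : 0 < a) (hab : 4 / Real.exp 1 * a < b) (hl : 0 < l) :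
    g a b l < 0 := by
  have hb : 0 < b := lt_trans (by positivity) hab
  have h1 := Real.add_one_le_exp (b / l - 1)
  have h2 : a * Real.exp (-b / l) < l / 4 := by
    have h3 : Real.exp (-b / l) = (Real.exp (b / l - 1) * Real.exp 1)⁻¹ := by
      rw [← Real.exp_add, ← Real.exp_neg]; congr 1; ring
    rw [h3, mul_inv, ← div_eq_mul_inv, mul_div_assoc', div_lt_iff₀ (Real.exp_pos 1)]
    have h4 : (Real.exp (b / l - 1))⁻¹ ≤ l / b := by
      rw [inv_le_comm₀ (Real.exp_pos _) (by positivity), inv_div]; linarith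
    have h5 : 4 * a < b * Real.exp 1 := by
      rw [div_mul_eq_mul_div, div_lt_iff₀ (Real.exp_pos 1)] at hab; exact hab
    calc a * (Real.exp (b / l - 1))⁻¹ ≤ a * (l / b) := by gcongr
      _ < _ := by
        rw [mul_div_assoc', div_lt_iff₀ hb]
        nlinarith
  unfold g h
  nlinarith

end Coefficients

/-! ### Green identities with the radial exponential -/

section Identities

/-- The homogeneous equation `-(1/r²) (r² f')' = g f`, with `f'` the derivative of `f`. -/
abbrev IsHomogeneous (a b lam : ℝ) (f f' : ℝ → ℝ) : Prop :=
  RadialEq f f' fun r => -(r ^ 2 * (g a b (lam * dH r) * f r))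

/-- The radial exponential `exp (lam / r)`, normalized to `1` at the cathode. -/
def radialExp (lam r : ℝ) : ℝ := Real.exp (lam / r - lam / 2)

theorem radialExp_two (lam : ℝ) : radialExp lam 2 = 1 := by simp [radialExp]

theorem radialExp_one (lam : ℝ) : radialExp lam 1 = Real.exp (lam / 2) := by
  rw [radialExp]; congr 1; ring

theorem exp_mul_exp_eq_radialExp (lam r : ℝ) :
    Real.exp (-(lam / 2) * H r) * Real.exp (lam / 2) = radialExp lam r := by
  rw [radialExp, ← Real.exp_add, H]
  congr 1
  ring

theorem hasDerivAt_radialExp (lam : ℝ) {r : ℝ} (hr : r ≠ 0) :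
    HasDerivAt (radialExp lam) (-(lam / r ^ 2 * radialExp lam r)) r := by
  have h1 : HasDerivAt (fun r : ℝ => lam / r - lam / 2) (-(lam / r ^ 2)) r :=
    (((hasDerivAt_const r lam).div (hasDerivAt_id r) hr).sub_const _).congr_deriv (by simp; ring)
  exact h1.exp.congr_deriv (by rw [radialExp]; ring)

theorem radialEq_radialExp (lam : ℝ) :
    RadialEq (radialExp lam) (fun r => -(lam / r ^ 2 * radialExp lam r))
      fun r => lam ^ 2 / r ^ 2 * radialExp lam r where
  hasDeriv r hr := (hasDerivAt_radialExp lam (by linarith [hr.1] : r ≠ 0)).hasDerivWithinAt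
  hasDeriv_flux r hr := by
    have hr0 : r ≠ 0 := by linarith [hr.1]
    have h1 := ((hasDerivAt_radialExp lam hr0).const_mul (-lam)).hasDerivWithinAt (s := Icc 1 2)
    refine (h1.congr (fun x hx => ?_) ?_).congr_deriv ?_
    · have hx0 : x ≠ 0 := by linarith [hx.1]
      field_simp
    · field_simp
    · ring
  cont := fun r hr => by
    have hr0 : r ≠ 0 := by linarith [hr.1]
    have h2 := (hasDerivAt_radialExp lam hr0).continuousAt
    exact (ContinuousAt.mul (by fun_prop (disch := positivity)) h2).continuousWithinAt

/-- Differentiating `radialExp` in lam gives (1/r - 1/2) times it, so this second test function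
carries the lam-variation of the exponential weight; it serves to simplify `F`. -/
theorem radialEq_mul_radialExp (lam : ℝ) :
    RadialEq (fun r => (1 - 1 / r) * radialExp lam r)
      (fun r => (1 - lam * (1 - 1 / r)) / r ^ 2 * radialExp lam r)
      fun r => (lam ^ 2 * (1 - 1 / r) - 2 * lam) / r ^ 2 * radialExp lam r where
  hasDeriv r hr := by
    have hr0 : r ≠ 0 := by linarith [hr.1]
    have h1 : HasDerivAt (fun r : ℝ => 1 - 1 / r) (1 / r ^ 2) r := by
      simpa using (hasDerivAt_inv hr0).const_sub 1
    exact ((h1.mul (hasDerivAt_radialExp lam hr0)).congr_deriv (by ring)).hasDerivWithinAt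
  hasDeriv_flux r hr := by
    have hr0 : r ≠ 0 := by linarith [hr.1]
    have h1 : HasDerivAt (fun r : ℝ => 1 - lam * (1 - 1 / r)) (-(lam * (1 / r ^ 2))) r := by
      have : HasDerivAt (fun r : ℝ => 1 - 1 / r) (1 / r ^ 2) r := by
        simpa using (hasDerivAt_inv hr0).const_sub 1
      simpa using (this.const_mul lam).const_sub 1
    refine (((h1.mul (hasDerivAt_radialExp lam hr0)).hasDerivWithinAt (s := Icc 1 2)).congr
      (fun x hx => ?_) ?_).congr_deriv (by ring)
    · have hx0 : x ≠ 0 := by linarith [hx.1]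
      simp only [Pi.mul_apply]
      field_simp
    · simp only [Pi.mul_apply]
      field_simp
  cont := fun r hr => by
    have hr0 : r ≠ 0 := by linarith [hr.1]
    have h2 := (hasDerivAt_radialExp lam hr0).continuousAt
    exact (ContinuousAt.mul (by fun_prop (disch := positivity)) h2).continuousWithinAt

variable {a b γ lam : ℝ} {φ φ' : ℝ → ℝ}

/-- Since g = h - lam²/r⁴, the lam² term cancels in Green's formula against `radialExp` and only the
integral with `h` is left. -/
theorem integral_h_radialExp (hφ : IsHomogeneous a b lam φ φ') (h1 : φ 1 = 0) :
    ∫ r in (1 : ℝ)..2, r ^ 2 * h a b (lam * dH r) * radialExp lam r * φ r =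
      Real.exp (lam / 2) * φ' 1 - (4 * φ' 2 + lam * φ 2) := by
  have h2 := hφ.integral_green (radialEq_radialExp lam)
  have h3 : ∫ r in (1 : ℝ)..2, r ^ 2 * h a b (lam * dH r) * radialExp lam r * φ r =
      ∫ r in (1 : ℝ)..2, -(-(r ^ 2 * (g a b (lam * dH r) * φ r)) * radialExp lam r -
        φ r * (lam ^ 2 / r ^ 2 * radialExp lam r)) := by
    refine intervalIntegral.integral_congr fun r hr => ?_
    rw [uIcc_of_le one_le_two] at hr
    have hr0 : r ≠ 0 := by linarith [hr.1]
    simp only [g_comp a b lam hr0]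
    field_simp
    ring
  rw [h3, intervalIntegral.integral_neg, h2, h1, radialExp_one, radialExp_two]
  ring

/-- The kernel of the cathode functional is γ/4 times r²h·`radialExp`, so the nonlocal term consists
of boundary values. -/
theorem B_eq (hφ : IsHomogeneous a b lam φ φ') (h1 : φ 1 = 0) :
    B a b γ lam φ =
      (1 + γ) * (φ' 2 + lam / 4 * φ 2) - γ / 4 * Real.exp (lam / 2) * φ' 1 := by
  have h2 : a * γ * (lam / 2) * Real.exp (-lam / 2) *
      (∫ r in (1 : ℝ)..2, Real.exp (-(b * r ^ 2) / (2 * lam)) * Real.exp (lam / r) * φ r) =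
      γ / 4 * ∫ r in (1 : ℝ)..2, r ^ 2 * h a b (lam * dH r) * radialExp lam r * φ r := by
    rw [← intervalIntegral.integral_const_mul, ← intervalIntegral.integral_const_mul]
    refine intervalIntegral.integral_congr fun r hr => ?_
    rw [uIcc_of_le one_le_two] at hr
    have hr0 : r ≠ 0 := by linarith [hr.1]
    have h3 : radialExp lam r = Real.exp (lam / r) * Real.exp (-lam / 2) := by
      rw [radialExp, ← Real.exp_add]; congr 1; ring
    simp only [h_comp a b lam hr0, h3]
    field_simp
    ring
  rw [B, h2, integral_h_radialExp hφ h1, hφ.dr_eq (right_mem_Icc.2 one_le_two)]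
  ring

theorem continuousOn_deriv_h_comp (a b : ℝ) (hl : 0 < lam) :
    ContinuousOn (fun r => deriv (h a b) (lam * dH r)) (Icc 1 2) := by
  have h1 : ContinuousOn (fun r => a * Real.exp (-b / (lam * dH r)) * (1 + b / (lam * dH r)))
      (Icc 1 2) := by
    have h2 : ContinuousOn (fun r => lam * dH r) (Icc 1 2) := by
      unfold dH
      exact continuousOn_const.mul (continuousOn_const.div (by fun_prop) fun r hr => by
        have := hr.1; positivity)
    have h3 : ∀ r ∈ Icc (1 : ℝ) 2, lam * dH r ≠ 0 := fun r hr => (mul_pos hl (dH_pos hr)).ne'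
    fun_prop (disch := assumption)
  exact h1.congr fun r hr => (hasDerivAt_h a b (mul_pos hl (dH_pos hr)).ne').deriv

theorem continuousOn_deriv_g_comp (a b : ℝ) (hl : 0 < lam) :
    ContinuousOn (fun r => deriv (g a b) (lam * dH r)) (Icc 1 2) := by
  have h2 : ContinuousOn (fun r => lam * dH r) (Icc 1 2) := by
    unfold dH
    exact continuousOn_const.mul (continuousOn_const.div (by fun_prop) fun r hr => by
      have := hr.1; positivity)
  exact ((continuousOn_deriv_h_comp a b hl).sub (h2.div_const 2)).congr fun r hr =>
    (hasDerivAt_g a b (mul_pos hl (dH_pos hr)).ne').deriv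

theorem F_eq {χ ψ : ℝ → ℝ} {c : ℝ} (hl : 0 < lam) (hφ : IsHomogeneous a b lam φ φ') (h1 : φ 1 = 0)
    (hχ : ContinuousOn χ (Icc 1 2)) (hχ2 : χ 2 = 1)
    (hψ : ∀ r ∈ Icc (1 : ℝ) 2, ψ r = c * ((1 + γ) * χ r - γ * radialExp lam r)) :
    F a b γ lam φ ψ = c * (1 + γ) * (φ 2 - 2 * φ' 2 - lam / 2 * φ 2 -
      ∫ r in (1 : ℝ)..2, r ^ 2 * χ r * deriv (g a b) (lam * dH r) * dH r * φ r) := by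
  have h2m : (2 : ℝ) ∈ Icc (1 : ℝ) 2 := right_mem_Icc.2 one_le_two
  have hψ2 : ψ 2 = c := by rw [hψ 2 h2m, hχ2, radialExp_two]; ring
  have hg := hφ.integral_green (radialEq_mul_radialExp lam)
  have hEc := (radialEq_radialExp lam).continuousOn
  have hψc : ContinuousOn ψ (Icc 1 2) :=
    (continuousOn_const.mul ((continuousOn_const.mul hχ).sub (continuousOn_const.mul hEc))).congr hψ
  have hdHc : ContinuousOn dH (Icc 1 2) := by
    unfold dH
    exact continuousOn_const.div (by fun_prop) fun r hr => by have := hr.1; positivity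
  have hHc : ContinuousOn H (Icc 1 2) := fun r hr =>
    (hasDerivAt_H (by linarith [hr.1])).continuousAt.continuousWithinAt
  have hφc := hφ.continuousOn
  have hhc := continuousOn_h_comp a b hl
  have hhc' := continuousOn_deriv_h_comp a b hl
  have hgc' := continuousOn_deriv_g_comp a b hl
  have i1 : IntervalIntegrable (fun r => r ^ 2 * ψ 2 *
        (deriv (h a b) (lam * dH r) * dH r - h a b (lam * dH r) * (H r / 2)) *
          Real.exp (-(lam / 2) * H r) * φ r) volume 1 2 :=
    ContinuousOn.intervalIntegrable_of_Icc one_le_two (by fun_prop)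
  have i2 : IntervalIntegrable (fun r => r ^ 2 * ψ r * deriv (g a b) (lam * dH r) * dH r * φ r)
      volume 1 2 := ContinuousOn.intervalIntegrable_of_Icc one_le_two (by fun_prop)
  have i3 : IntervalIntegrable (fun r => r ^ 2 * χ r * deriv (g a b) (lam * dH r) * dH r * φ r)
      volume 1 2 := ContinuousOn.intervalIntegrable_of_Icc one_le_two (by fun_prop)
  have i4 : IntervalIntegrable (fun r => -(r ^ 2 * (g a b (lam * dH r) * φ r)) *
      ((1 - 1 / r) * radialExp lam r) -
      φ r * ((lam ^ 2 * (1 - 1 / r) - 2 * lam) / r ^ 2 * radialExp lam r)) volume 1 2 :=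
    ContinuousOn.intervalIntegrable_of_Icc one_le_two
      ((hφ.cont.mul (radialEq_mul_radialExp lam).continuousOn).sub
        (hφ.continuousOn.mul (radialEq_mul_radialExp lam).cont))
  rw [F, ← intervalIntegral.integral_const_mul, ← intervalIntegral.integral_sub (i1.const_mul _) i2]
  -- The terms γE·h' cancel between the two integrals. What remains with the factor γ is r²Eφ(h(1 -
  -- 1/r) - 2lam/r⁴), which is up to sign the Green integrand for φ and (1 - 1/r)E.
  have key : ∫ r in (1 : ℝ)..2, (-γ * Real.exp (lam / 2) * (r ^ 2 * ψ 2 *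
        (deriv (h a b) (lam * dH r) * dH r - h a b (lam * dH r) * (H r / 2)) *
          Real.exp (-(lam / 2) * H r) * φ r) -
        r ^ 2 * ψ r * deriv (g a b) (lam * dH r) * dH r * φ r) =
      ∫ r in (1 : ℝ)..2, (-(c * γ) * (-(r ^ 2 * (g a b (lam * dH r) * φ r)) *
      ((1 - 1 / r) * radialExp lam r) -
      φ r * ((lam ^ 2 * (1 - 1 / r) - 2 * lam) / r ^ 2 * radialExp lam r)) -
      c * (1 + γ) * (r ^ 2 * χ r * deriv (g a b) (lam * dH r) * dH r * φ r)) := by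
    refine intervalIntegral.integral_congr fun r hr => ?_
    rw [uIcc_of_le one_le_two] at hr
    have hr0 : r ≠ 0 := by linarith [hr.1]
    rw [hψ2, hψ r hr, (hasDerivAt_g a b (mul_pos hl (dH_pos hr)).ne').deriv, g_comp a b lam hr0,
      ← exp_mul_exp_eq_radialExp]
    generalize deriv (h a b) (lam * dH r) = D
    generalize h a b (lam * dH r) = N
    generalize Real.exp (-(lam / 2) * H r) = X
    unfold H dH
    field_simp
    ring
  rw [key, intervalIntegral.integral_sub (i4.const_mul _) (i3.const_mul _),
    intervalIntegral.integral_const_mul, intervalIntegral.integral_const_mul, hg, hψ2,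
    hφ.dr_eq h2m, h1, radialExp_two]
  ring

end Identities

/-! ### Reduction of the adjoint problem to the homogeneous equation -/

section Adjoint

variable {a b γ lam : ℝ}

theorem IsElectronSolution.isHomogeneous {φ : ℝ → ℝ} (hl : 0 < lam)
    (h : IsElectronSolution a b γ lam φ) : IsHomogeneous a b lam φ (dr φ) :=
  h.eqn.radialEq h.memH2 ((continuousOn_g_comp a b hl).mul h.memH2.1)

/-- The nonlocal source is γc·h times `radialExp`, and `radialExp` solves the equation with `h`
removed; adding γc·`radialExp` therefore absorbs the source. -/
theorem radialExp_source (a b γ lam c : ℝ) (r : ℝ) (hr : r ≠ 0) (y : ℝ) :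
    -(r ^ 2 * (g a b (lam * dH r) * y
      + h a b (lam * dH r) * Real.exp (-(lam / 2) * H r) * γ * Real.exp (lam / 2) * c)) +
      γ * c * (lam ^ 2 / r ^ 2 * radialExp lam r) =
    -(r ^ 2 * (g a b (lam * dH r) * (y + γ * c * radialExp lam r))) := by
  rw [g_comp a b lam hr, ← exp_mul_exp_eq_radialExp]
  field_simp
  ring

theorem continuousOn_adjoint_source (a b γ c : ℝ) {ψ : ℝ → ℝ} (hl : 0 < lam)
    (hψ : ContinuousOn ψ (Icc 1 2)) : ContinuousOn (fun r => g a b (lam * dH r) * ψ r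
      + h a b (lam * dH r) * Real.exp (-(lam / 2) * H r) * γ * Real.exp (lam / 2) * c)
      (Icc 1 2) := by
  have hHc : ContinuousOn H (Icc 1 2) := fun r hr =>
    (hasDerivAt_H (by linarith [hr.1])).continuousAt.continuousWithinAt
  have hgc := continuousOn_g_comp a b hl
  have hhc := continuousOn_h_comp a b hl
  fun_prop

theorem IsAdjointSolution.isHomogeneous {ψ : ℝ → ℝ} (hl : 0 < lam)
    (h : IsAdjointSolution a b γ lam ψ) :
    IsHomogeneous a b lam (fun r => ψ r + γ * ψ 2 * radialExp lam r)
      (fun r => dr ψ r + γ * ψ 2 * -(lam / r ^ 2 * radialExp lam r)) := by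
  have h1 := h.eqn.radialEq h.memH2 (continuousOn_adjoint_source a b γ (ψ 2) hl h.memH2.1)
  refine (h1.add ((radialEq_radialExp lam).const_mul (γ * ψ 2))).congr (fun _ _ => rfl)
    (fun _ _ => rfl) fun r hr => ?_
  exact (radialExp_source a b γ lam (ψ 2) r (by linarith [hr.1]) (ψ r)).symm

/-- The hypothesis on χ(1) is the anode condition for the resulting ψ. For the χ used later it
coincides with the electron equation, by `K_eq_w_one`. -/
theorem isAdjointSolution_of_isHomogeneous {χ χ' : ℝ → ℝ}
    (hχ : IsHomogeneous a b lam χ χ') (h2 : χ 2 = 1) (h2' : χ' 2 = -(lam / 4))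
    (h1 : (1 + γ) * χ 1 = γ * Real.exp (lam / 2)) :
    IsAdjointSolution a b γ lam fun r => (1 + γ) * χ r - γ * radialExp lam r := by
  have hv : (1 + γ) * χ 2 - γ * radialExp lam 2 = 1 := by rw [h2, radialExp_two]; ring
  have hψ := (hχ.const_mul (1 + γ)).add ((radialEq_radialExp lam).const_mul (-γ))
  have hψ' : RadialEq (fun r => (1 + γ) * χ r - γ * radialExp lam r)
      (fun r => (1 + γ) * χ' r + -γ * -(lam / r ^ 2 * radialExp lam r))
      (fun r => -(r ^ 2 * (g a b (lam * dH r) * ((1 + γ) * χ r - γ * radialExp lam r)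
    + h a b (lam * dH r) * Real.exp (-(lam / 2) * H r) * γ * Real.exp (lam / 2) *
      ((1 + γ) * χ 2 - γ * radialExp lam 2)))) := by
    refine hψ.congr (fun r _ => by simp only; ring) (fun _ _ => rfl) fun r hr => ?_
    have h3 := radialExp_source a b γ lam 1 r (by linarith [hr.1])
      ((1 + γ) * χ r - γ * radialExp lam r)
    simp only [hv]
    linarith
  refine ⟨hψ'.memH2, hψ'.negRadialLaplacianEq, ?_, ?_⟩
  · simp only [h1, radialExp_one, sub_self]
  · rw [hψ'.dr_eq (right_mem_Icc.2 one_le_two)]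
    simp only [h2, h2', radialExp_two]
    ring

/-- Every nontrivial solution of the adjoint problem is a multiple of the one built from the
homogeneous solution `χ` with `χ(2) = 1` and `χ'(2) = -lam/4`. -/
theorem IsAdjointSolution.exists_eq {ψ χ χ' : ℝ → ℝ} (hl : 0 < lam)
    (h : IsAdjointSolution a b γ lam ψ) (hne : ∃ r ∈ Icc (1 : ℝ) 2, ψ r ≠ 0)
    (hχ : IsHomogeneous a b lam χ χ') (h2 : χ 2 = 1) (h2' : χ' 2 = -(lam / 4)) :
    ∃ c ≠ 0, ∀ r ∈ Icc (1 : ℝ) 2, ψ r = c * ((1 + γ) * χ r - γ * radialExp lam r) := by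
  have hd := (h.isHomogeneous hl).add (hχ.const_mul (-((1 + γ) * ψ 2)))
  have hz : EqOn (fun r => ψ r + γ * ψ 2 * radialExp lam r + -((1 + γ) * ψ 2) * χ r) 0
      (Icc 1 2) := by
    refine RadialEq.eqOn_zero (w := fun r => -(r ^ 2 * g a b (lam * dH r)))
      (hd.congr (fun _ _ => rfl) (fun _ _ => rfl) fun r _ => by simp only; ring)
      (((continuousOn_pow 2).mul (continuousOn_g_comp a b hl)).neg) (Or.inr ⟨?_, ?_⟩)
    · simp only [h2, radialExp_two]; ring
    · have := h.cathode
      simp only [h2', radialExp_two]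
      linear_combination this
  have hψ : ∀ r ∈ Icc (1 : ℝ) 2, ψ r = ψ 2 * ((1 + γ) * χ r - γ * radialExp lam r) := by
    intro r hr
    have := hz hr
    simp only [Pi.zero_apply] at this
    linear_combination this
  refine ⟨ψ 2, fun h0 => ?_, hψ⟩
  obtain ⟨r, hr, hr'⟩ := hne
  exact hr' (by rw [hψ r hr, h0, zero_mul])

end Adjoint

/-! ### Shooting solutions and the scalar function G of the log voltage -/

section Shooting

/-- The projection of the line to `[1,2]`. -/
def clip (r : ℝ) : ℝ := max 1 (min 2 r)

theorem clip_mem (r : ℝ) : clip r ∈ Icc (1 : ℝ) 2 :=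
  ⟨le_max_left _ _, max_le one_le_two (min_le_left _ _)⟩

theorem clip_of_mem {r : ℝ} (hr : r ∈ Icc (1 : ℝ) 2) : clip r = r := by
  rw [clip, min_eq_right hr.2, max_eq_right hr.1]

/-- The electric field `lam ∂_r H` at the voltage `lam = exp p.2.2`. -/
def field (p : ℝ × ℝ × ℝ) (r : ℝ) : ℝ := Real.exp p.2.2 * dH (clip r)

theorem field_pos (p : ℝ × ℝ × ℝ) (r : ℝ) : 0 < field p r :=
  mul_pos (Real.exp_pos _) (dH_pos (clip_mem r))

theorem field_le (p : ℝ × ℝ × ℝ) (r : ℝ) : field p r ≤ 2 * Real.exp p.2.2 := by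
  have h1 : dH (clip r) ≤ 2 := div_le_self zero_le_two (one_le_pow₀ (clip_mem r).1)
  unfold field
  nlinarith [Real.exp_pos p.2.2]

theorem le_field (p : ℝ × ℝ × ℝ) (r : ℝ) : Real.exp p.2.2 / 2 ≤ field p r := by
  have h1 : 1 / 2 ≤ dH (clip r) := by
    unfold dH
    have h2 := clip_mem r
    rw [div_le_div_iff₀ two_pos (by have := h2.1; positivity)]
    nlinarith [h2.1, h2.2]
  unfold field
  nlinarith [Real.exp_pos p.2.2]

theorem continuous_field : Continuous (Function.uncurry field) := by
  have h1 : Continuous clip := by unfold clip; fun_prop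
  have h2 : ∀ r, clip r ^ 2 ≠ 0 := fun r => by have := (clip_mem r).1; positivity
  unfold Function.uncurry field dH
  fun_prop (disch := simp [h2])

/-- The coefficient of `u'' = q u`, the equation for `u = r φ`. -/
def pot (p : ℝ × ℝ × ℝ) (r : ℝ) : ℝ := -g p.1 p.2.1 (field p r)

/-- The derivative of `pot` with respect to the logarithm of the voltage. -/
def potDeriv (p : ℝ × ℝ × ℝ) (r : ℝ) : ℝ :=
  -((p.1 * Real.exp (-p.2.1 / field p r) * (1 + p.2.1 / field p r) - field p r / 2) * field p r)

theorem deriv_g_eq (a b : ℝ) {l : ℝ} (hl : l ≠ 0) :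
    deriv (g a b) l = a * Real.exp (-b / l) * (1 + b / l) - l / 2 := by
  rw [(hasDerivAt_g a b hl).deriv, (hasDerivAt_h a b hl).deriv]

theorem hasDerivAt_pot (a b τ r : ℝ) :
    HasDerivAt (fun t => pot (a, b, t) r) (potDeriv (a, b, τ) r) τ := by
  have h0 := (field_pos (a, b, τ) r).ne'
  have h1 : HasDerivAt (fun t => field (a, b, t) r) (field (a, b, τ) r) τ :=
    (Real.hasDerivAt_exp τ).mul_const _
  have h2 := ((hasDerivAt_g a b h0).comp τ h1).neg
  refine h2.congr_deriv ?_
  rw [potDeriv, (hasDerivAt_h a b h0).deriv]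

theorem continuous_pot : Continuous (Function.uncurry pot) := by
  have h1 := continuous_field
  have h2 : ∀ x : (ℝ × ℝ × ℝ) × ℝ, Function.uncurry field x ≠ 0 := fun x => (field_pos x.1 x.2).ne'
  have h3 : Function.uncurry pot = fun x => -(x.1.1 * Function.uncurry field x *
      Real.exp (-x.1.2.1 / Function.uncurry field x) - Function.uncurry field x ^ 2 / 4) := rfl
  rw [h3]
  fun_prop (disch := exact h2 _)

theorem continuous_potDeriv : Continuous (Function.uncurry potDeriv) := by
  have h1 := continuous_field
  have h2 : ∀ x : (ℝ × ℝ × ℝ) × ℝ, Function.uncurry field x ≠ 0 := fun x => (field_pos x.1 x.2).ne'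
  have h3 : Function.uncurry potDeriv = fun x => -((x.1.1 *
      Real.exp (-x.1.2.1 / Function.uncurry field x) * (1 + x.1.2.1 / Function.uncurry field x) -
      Function.uncurry field x / 2) * Function.uncurry field x) := rfl
  rw [h3]
  fun_prop (disch := exact h2 _)

/-- Clipping the radius keeps the field between exp(τ)/2 and 2exp(τ) on the whole line, so the bound
is uniform in `r` and continuous in the parameters, whatever the signs of a and b. -/
theorem abs_pot_le (p : ℝ × ℝ × ℝ) (r : ℝ) : |pot p r| ≤
    |p.1| * (2 * Real.exp p.2.2) * Real.exp (2 * |p.2.1| / Real.exp p.2.2) +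
      (2 * Real.exp p.2.2) ^ 2 / 4 := by
  have h0 := field_pos p r
  have h1 := field_le p r
  have h2 := le_field p r
  have h3 : -p.2.1 / field p r ≤ 2 * |p.2.1| / Real.exp p.2.2 := by
    calc -p.2.1 / field p r ≤ |p.2.1| / field p r := by gcongr; exact neg_le_abs _
      _ ≤ |p.2.1| / (Real.exp p.2.2 / 2) := by gcongr
      _ = _ := by field_simp
  rw [pot, abs_neg, g, h]
  refine (abs_sub _ _).trans (add_le_add ?_ ?_)
  · rw [abs_mul, abs_mul, abs_of_pos h0, abs_of_pos (Real.exp_pos _)]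
    gcongr
  · rw [abs_of_nonneg (by positivity)]
    gcongr

/-- Solutions of `u'' = q u` for all parameters `(a, b, log lam)`: `u` starts from the anode, and
`w` satisfies, after division by `r`, the cathode conditions `χ(2) = 1`, `χ'(2) = -lam/4`. -/
structure ShootingFamily where
  /-- the solution with `u(1) = 0`, `u'(1) = 1` -/
  u : ℝ × ℝ × ℝ → ℝ → ℝ
  /-- the derivative of `u` -/
  u' : ℝ × ℝ × ℝ → ℝ → ℝ
  /-- the solution with `w(2) = 2`, `w'(2) = 1 - lam/2` -/
  w : ℝ × ℝ × ℝ → ℝ → ℝ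
  /-- the derivative of `w` -/
  w' : ℝ × ℝ × ℝ → ℝ → ℝ
  continuous_u : Continuous (Function.uncurry u)
  continuous_u' : Continuous (Function.uncurry u')
  continuous_w : Continuous (Function.uncurry w)
  u_one : ∀ p, u p 1 = 0
  u'_one : ∀ p, u' p 1 = 1
  w_two : ∀ p, w p 2 = 2
  w'_two : ∀ p, w' p 2 = 1 - Real.exp p.2.2 / 2
  hasDerivAt_u : ∀ p r, HasDerivAt (u p) (u' p r) r
  hasDerivAt_u' : ∀ p r, HasDerivAt (u' p) (pot p r * u p r) r
  hasDerivAt_w : ∀ p r, HasDerivAt (w p) (w' p r) r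
  hasDerivAt_w' : ∀ p r, HasDerivAt (w' p) (pot p r * w p r) r

theorem nonempty_shootingFamily : Nonempty ShootingFamily := by
  have hM : Continuous fun p : ℝ × ℝ × ℝ =>
      |p.1| * (2 * Real.exp p.2.2) * Real.exp (2 * |p.2.1| / Real.exp p.2.2) +
      (2 * Real.exp p.2.2) ^ 2 / 4 := by
    fun_prop (disch := simp)
  obtain ⟨u, u', h1, h2, h3, h4, h5, h6⟩ := exists_secondOrder_solution continuous_pot hM
    abs_pot_le (α := fun _ => 0) (β := fun _ => 1) continuous_const continuous_const 1
  obtain ⟨w, w', k1, k2, k3, k4, k5, k6⟩ := exists_secondOrder_solution continuous_pot hM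
    abs_pot_le (α := fun _ => 2) (β := fun p => 1 - Real.exp p.2.2 / 2) continuous_const
    (by fun_prop) 2
  exact ⟨⟨u, u', w, w', h1, h2, k1, h3, h4, k3, k4, h5, h6, k5, k6⟩⟩

/-- For φ = u/r the flux r²φ' equals ru' - u, whose derivative is ru''; the first-order term
disappears. -/
theorem isHomogeneous_of_secondOrder {p : ℝ × ℝ × ℝ} {u u' : ℝ → ℝ}
    (hu : ∀ r, HasDerivAt u (u' r) r) (hu' : ∀ r, HasDerivAt u' (pot p r * u r) r) :
    IsHomogeneous p.1 p.2.1 (Real.exp p.2.2) (fun r => u r / r)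
      (fun r => u' r / r - u r / r ^ 2) where
  hasDeriv r hr := by
    have hr0 : r ≠ 0 := by linarith [hr.1]
    refine (((hu r).div (hasDerivAt_id r) hr0).congr_deriv ?_).hasDerivWithinAt
    simp only [id]
    field_simp
  hasDeriv_flux r hr := by
    have hr0 : r ≠ 0 := by linarith [hr.1]
    have h1 := (((hasDerivAt_id r).mul (hu' r)).sub (hu r)).hasDerivWithinAt (s := Icc 1 2)
    refine (h1.congr (fun x hx => ?_) ?_).congr_deriv ?_
    · have hx0 : x ≠ 0 := by linarith [hx.1]
      simp only [Pi.sub_apply, Pi.mul_apply, id]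
      field_simp
    · simp only [Pi.sub_apply, Pi.mul_apply, id]
      field_simp
    · simp only [id, pot, field, clip_of_mem hr]
      field_simp
      ring
  cont := by
    have h1 : Continuous u := continuous_iff_continuousAt.2 fun r => (hu r).continuousAt
    have h2 := continuousOn_g_comp p.1 p.2.1 (Real.exp_pos p.2.2)
    have h3 : ContinuousOn (fun r => u r / r) (Icc 1 2) :=
      h1.continuousOn.div continuousOn_id fun r hr => by have := hr.1; positivity
    fun_prop

/-- At a zero of `m`, mere continuity of `n` suffices. This lets `K` be differentiated although `u`
is known only to be continuous in the voltage. -/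
theorem hasDerivAt_mul_of_eq_zero {m n : ℝ → ℝ} {m' x : ℝ} (hm : HasDerivAt m m' x)
    (h0 : m x = 0) (hn : ContinuousAt n x) : HasDerivAt (fun y => m y * n y) (m' * n x) x := by
  rw [hasDerivAt_iff_tendsto_slope] at hm ⊢
  refine (hm.mul (hn.tendsto.mono_left nhdsWithin_le_nhds)).congr fun y => ?_
  simp only [slope_def_field, h0]
  ring

namespace ShootingFamily

variable (S : ShootingFamily)

/-- The cathode value `4 φ'(2) + lam φ(2)` for `φ = u / r`. -/
def K (p : ℝ × ℝ × ℝ) : ℝ := 2 * S.u' p 2 - S.u p 2 + Real.exp p.2.2 / 2 * S.u p 2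

/-- The derivative of `K` with respect to the logarithm of the voltage. -/
def K' (p : ℝ × ℝ × ℝ) : ℝ :=
  Real.exp p.2.2 * (S.u p 2 / 2) + ∫ r in (1 : ℝ)..2, potDeriv p r * S.u p r * S.w p r

/-- The normalized cathode value. The electron system with coefficient `γ` is solvable
if and only if `(1 + γ) G = γ`. -/
def G (p : ℝ × ℝ × ℝ) : ℝ := Real.exp (-(Real.exp p.2.2 / 2)) * S.K p

/-- The derivative of `G` with respect to the logarithm of the voltage. -/
def G' (p : ℝ × ℝ × ℝ) : ℝ :=
  Real.exp (-(Real.exp p.2.2 / 2)) * (S.K' p - Real.exp p.2.2 / 2 * S.K p)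

theorem continuous_K : Continuous S.K := by
  have h1 : Continuous fun p => S.u p 2 := S.continuous_u.comp (Continuous.prodMk_left 2)
  have h2 : Continuous fun p => S.u' p 2 := S.continuous_u'.comp (Continuous.prodMk_left 2)
  unfold K
  fun_prop

theorem continuous_G : Continuous S.G := by
  have := S.continuous_K
  unfold G
  fun_prop

theorem continuous_G' : Continuous S.G' := by
  have h0 := S.continuous_K
  have h1 : Continuous fun p => S.u p 2 := S.continuous_u.comp (Continuous.prodMk_left 2)
  have h2 : Continuous fun p => ∫ r in (1 : ℝ)..2, potDeriv p r * S.u p r * S.w p r :=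
    intervalIntegral.continuous_parametric_intervalIntegral_of_continuous'
      ((continuous_potDeriv.mul S.continuous_u).mul S.continuous_w) 1 2
  unfold G' K'
  fun_prop

/-- Integrate the derivative of the Wronskian of `u` at voltage exp σ and `w` at voltage exp τ. The
cathode data of `w` produce `K` at σ up to the explicit voltage difference, and the anode
contributes w(1). -/
theorem K_sub (a b σ τ : ℝ) : S.K (a, b, σ) = S.w (a, b, τ) 1 +
    (Real.exp σ - Real.exp τ) * (S.u (a, b, σ) 2 / 2) +
    ∫ r in (1 : ℝ)..2, (pot (a, b, σ) r - pot (a, b, τ) r) *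
      (S.u (a, b, σ) r * S.w (a, b, τ) r) := by
  have hd : ∀ r, HasDerivAt
      (fun r => S.u' (a, b, σ) r * S.w (a, b, τ) r - S.u (a, b, σ) r * S.w' (a, b, τ) r)
      ((pot (a, b, σ) r - pot (a, b, τ) r) * (S.u (a, b, σ) r * S.w (a, b, τ) r)) r := fun r =>
    (((S.hasDerivAt_u' (a, b, σ) r).mul (S.hasDerivAt_w (a, b, τ) r)).sub
      ((S.hasDerivAt_u (a, b, σ) r).mul (S.hasDerivAt_w' (a, b, τ) r))).congr_deriv (by ring)
  have hc : Continuous fun r =>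
      (pot (a, b, σ) r - pot (a, b, τ) r) * (S.u (a, b, σ) r * S.w (a, b, τ) r) :=
    ((continuous_pot.comp (Continuous.prodMk_right _)).sub
      (continuous_pot.comp (Continuous.prodMk_right _))).mul
      ((S.continuous_u.comp (Continuous.prodMk_right _)).mul
        (S.continuous_w.comp (Continuous.prodMk_right _)))
  rw [intervalIntegral.integral_eq_sub_of_hasDerivAt (fun r _ => hd r) (hc.intervalIntegrable _ _)]
  simp only [S.u_one, S.u'_one, S.w_two, S.w'_two, K]
  ring

theorem K_eq_w_one (a b τ : ℝ) : S.K (a, b, τ) = S.w (a, b, τ) 1 := by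
  simpa using S.K_sub a b τ τ

theorem hasDerivAt_K (a b τ : ℝ) :
    HasDerivAt (fun σ => S.K (a, b, σ)) (S.K' (a, b, τ)) τ := by
  have hP : Continuous fun x : ℝ × ℝ × ℝ => ((a, b, τ + x.2.2 * (x.1 - τ)), x.2.1) := by fun_prop
  have hσ : Continuous fun x : ℝ × ℝ => ((a, b, x.1), x.2) := by fun_prop
  -- Hadamard's quotient (pot σ - pot τ)/(σ - τ), written as an average of the derivative so that it
  -- is jointly continuous also at σ = τ.
  set k : ℝ → ℝ → ℝ := fun σ r => ∫ s in (0 : ℝ)..1, potDeriv (a, b, τ + s * (σ - τ)) r with hk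
  have hkc : Continuous (Function.uncurry k) := by
    refine intervalIntegral.continuous_parametric_intervalIntegral_of_continuous'
      (f := fun (x : ℝ × ℝ) s => potDeriv (a, b, τ + s * (x.1 - τ)) x.2) ?_ 0 1
    exact continuous_potDeriv.comp (show Continuous fun x : (ℝ × ℝ) × ℝ =>
      ((a, b, τ + x.2 * (x.1.1 - τ)), x.1.2) by fun_prop)
  have hkd : ∀ σ r, pot (a, b, σ) r - pot (a, b, τ) r = (σ - τ) * k σ r := by
    intro σ r
    have h1 : ∀ s : ℝ, HasDerivAt (fun s => pot (a, b, τ + s * (σ - τ)) r)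
        (potDeriv (a, b, τ + s * (σ - τ)) r * (σ - τ)) s := fun s => by
      have h2 : HasDerivAt (fun s : ℝ => τ + s * (σ - τ)) (σ - τ) s := by
        simpa using ((hasDerivAt_id s).mul_const (σ - τ)).const_add τ
      exact (hasDerivAt_pot a b _ r).comp s h2
    have h3 : Continuous fun s : ℝ => potDeriv (a, b, τ + s * (σ - τ)) r :=
      continuous_potDeriv.comp (show Continuous fun s : ℝ => ((a, b, τ + s * (σ - τ)), r) by
        fun_prop)
    have h4 := intervalIntegral.integral_eq_sub_of_hasDerivAt (a := 0) (b := 1)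
      (fun s _ => h1 s) ((h3.mul continuous_const).intervalIntegrable _ _)
    rw [intervalIntegral.integral_mul_const] at h4
    simp only [one_mul, zero_mul, add_zero, add_sub_cancel] at h4
    rw [← h4, mul_comm]
  have huc : Continuous fun x : ℝ × ℝ => S.u (a, b, x.1) x.2 := S.continuous_u.comp hσ
  have hwc : Continuous fun r => S.w (a, b, τ) r := S.continuous_w.comp (Continuous.prodMk_right _)
  have hN : Continuous fun σ => ∫ r in (1 : ℝ)..2, k σ r * (S.u (a, b, σ) r * S.w (a, b, τ) r) :=
    intervalIntegral.continuous_parametric_intervalIntegral_of_continuous'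
      (hkc.mul (huc.mul (hwc.comp continuous_snd))) 1 2
  have h1 : HasDerivAt (fun σ => (Real.exp σ - Real.exp τ) * (S.u (a, b, σ) 2 / 2))
      (Real.exp τ * (S.u (a, b, τ) 2 / 2)) τ :=
    hasDerivAt_mul_of_eq_zero (n := fun σ => S.u (a, b, σ) 2 / 2)
      ((Real.hasDerivAt_exp τ).sub_const _) (sub_self _)
      ((huc.comp (Continuous.prodMk_left 2)).div_const 2).continuousAt
  have h2 := hasDerivAt_mul_of_eq_zero ((hasDerivAt_id τ).sub_const τ) (sub_self _) hN.continuousAt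
  have h3 := (h1.add h2).const_add (S.w (a, b, τ) 1)
  refine (h3.congr_of_eventuallyEq (Filter.Eventually.of_forall fun σ => ?_)).congr_deriv ?_
  · simp only [S.K_sub a b σ τ, hkd, Pi.add_apply, id, ← intervalIntegral.integral_const_mul,
      mul_assoc, add_assoc]
  · simp [K', hk, mul_assoc]

theorem hasDerivAt_G (a b τ : ℝ) :
    HasDerivAt (fun σ => S.G (a, b, σ)) (S.G' (a, b, τ)) τ := by
  have h1 := ((Real.hasDerivAt_exp τ).div_const 2).neg.exp
  refine (h1.mul (S.hasDerivAt_K a b τ)).congr_deriv ?_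
  simp only [G', Pi.neg_apply]
  ring

theorem isHomogeneous_u (a b τ : ℝ) :
    IsHomogeneous a b (Real.exp τ) (fun r => S.u (a, b, τ) r / r)
      (fun r => S.u' (a, b, τ) r / r - S.u (a, b, τ) r / r ^ 2) :=
  isHomogeneous_of_secondOrder (S.hasDerivAt_u (a, b, τ)) (S.hasDerivAt_u' (a, b, τ))

theorem isHomogeneous_w (a b τ : ℝ) :
    IsHomogeneous a b (Real.exp τ) (fun r => S.w (a, b, τ) r / r)
      (fun r => S.w' (a, b, τ) r / r - S.w (a, b, τ) r / r ^ 2) :=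
  isHomogeneous_of_secondOrder (S.hasDerivAt_w (a, b, τ)) (S.hasDerivAt_w' (a, b, τ))

end ShootingFamily

end Shooting

/-! ### Positivity and two-sided bounds for G -/

section Estimates

namespace ShootingFamily

variable (S : ShootingFamily)

/-- Since (uu')' = u'² + qu² ≥ 0 and u(1) = 0, the product uu' is nonnegative to the right of 1.
Hence u'² increases from 1, and u' cannot change sign without vanishing. -/
theorem one_le_u' {p : ℝ × ℝ × ℝ} (hq : ∀ r, 0 ≤ pot p r) {r : ℝ} (hr : 1 ≤ r) :
    1 ≤ S.u' p r := by
  have hm1 : Monotone fun r => S.u p r * S.u' p r := by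
    refine monotone_of_hasDerivAt_nonneg
      (fun r => (S.hasDerivAt_u p r).mul (S.hasDerivAt_u' p r)) fun r => ?_
    simp only [Pi.zero_apply]
    nlinarith [mul_nonneg (hq r) (sq_nonneg (S.u p r)), sq_nonneg (S.u' p r)]
  have h1 : ∀ s, 1 ≤ s → 0 ≤ S.u p s * S.u' p s := fun s hs => by
    have := hm1 hs
    simpa [S.u_one] using this
  have hc : Continuous (S.u' p) := S.continuous_u'.comp (Continuous.prodMk_right p)
  have hd : ∀ s, HasDerivAt (fun s => S.u' p s ^ 2) (2 * (pot p s * (S.u p s * S.u' p s))) s :=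
    fun s => ((S.hasDerivAt_u' p s).pow 2).congr_deriv (by ring)
  have hm2 : MonotoneOn (fun s => S.u' p s ^ 2) (Ici 1) := by
    refine monotoneOn_of_hasDerivWithinAt_nonneg (convex_Ici 1) (hc.pow 2).continuousOn
      (fun s _ => (hd s).hasDerivWithinAt) fun s hs => ?_
    rw [interior_Ici] at hs
    have := mul_nonneg (hq s) (h1 s (le_of_lt hs))
    linarith
  have h2 : ∀ s, 1 ≤ s → 1 ≤ S.u' p s ^ 2 := fun s hs => by
    have := hm2 self_mem_Ici hs hs
    simpa [S.u'_one] using this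
  have h3 : 0 ≤ S.u' p r := by
    by_contra! hneg
    obtain ⟨s, hs, hs0⟩ := intermediate_value_Icc' hr hc.continuousOn
      (show (0 : ℝ) ∈ Icc (S.u' p r) (S.u' p 1) from ⟨hneg.le, by rw [S.u'_one]; exact zero_le_one⟩)
    have := h2 s hs.1
    rw [hs0] at this
    norm_num at this
  nlinarith [h2 r hr]

theorem sub_one_le_u {p : ℝ × ℝ × ℝ} (hq : ∀ r, 0 ≤ pot p r) {r : ℝ} (hr : 1 ≤ r) :
    r - 1 ≤ S.u p r := by
  have hc : Continuous (S.u p) := S.continuous_u.comp (Continuous.prodMk_right p)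
  have hm : MonotoneOn (fun s => S.u p s - s) (Ici 1) := by
    refine monotoneOn_of_hasDerivWithinAt_nonneg (convex_Ici 1) (hc.sub continuous_id).continuousOn
      (fun s _ => ((S.hasDerivAt_u p s).sub (hasDerivAt_id s)).hasDerivWithinAt) fun s hs => ?_
    rw [interior_Ici] at hs
    have := S.one_le_u' hq (le_of_lt hs)
    linarith
  have := hm self_mem_Ici hr hr
  simp only [S.u_one] at this
  linarith

/-- The factor `exp (-lam (1 - 1/r))` times the solution `φ = u/r`. -/
def z (p : ℝ × ℝ × ℝ) (r : ℝ) : ℝ := Real.exp (-(Real.exp p.2.2 * (1 - 1 / r))) * (S.u p r / r)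

/-- The factor `exp (-lam (1 - 1/r))` times the flux `r² φ' + lam φ`. -/
def y (p : ℝ × ℝ × ℝ) (r : ℝ) : ℝ := Real.exp (-(Real.exp p.2.2 * (1 - 1 / r))) *
  (r * S.u' p r - S.u p r + Real.exp p.2.2 * (S.u p r / r))

theorem hasDerivAt_exp_one_sub (c : ℝ) {r : ℝ} (hr : r ≠ 0) :
    HasDerivAt (fun r => Real.exp (c * (1 - 1 / r)))
      (Real.exp (c * (1 - 1 / r)) * (c * (1 / r ^ 2))) r := by
  have : HasDerivAt (fun r : ℝ => 1 - 1 / r) (1 / r ^ 2) r := by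
    simpa using (hasDerivAt_inv hr).const_sub 1
  exact (this.const_mul c).exp

theorem hasDerivAt_z (p : ℝ × ℝ × ℝ) {r : ℝ} (hr : r ∈ Icc (1 : ℝ) 2) :
    HasDerivAt (S.z p) ((S.y p r - 2 * Real.exp p.2.2 * S.z p r) / r ^ 2) r := by
  have hr0 : r ≠ 0 := by linarith [hr.1]
  have h1 := hasDerivAt_exp_one_sub (-Real.exp p.2.2) hr0
  simp only [neg_mul] at h1
  refine (h1.mul ((S.hasDerivAt_u p r).div (hasDerivAt_id r) hr0)).congr_deriv ?_
  simp only [id, y, z, Pi.div_apply]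
  field_simp
  ring

/-- The weight is a constant multiple of `radialExp`, so the lam² terms cancel and only ionization
drives `y`, from 1 at the anode to `G` at the cathode. -/
theorem hasDerivAt_y (p : ℝ × ℝ × ℝ) {r : ℝ} (hr : r ∈ Icc (1 : ℝ) 2) :
    HasDerivAt (S.y p) (-(2 * p.1 * Real.exp p.2.2 *
      Real.exp (-(p.2.1 * r ^ 2) / (2 * Real.exp p.2.2)) * S.z p r)) r := by
  have hr0 : r ≠ 0 := by linarith [hr.1]
  have h1 := hasDerivAt_exp_one_sub (-Real.exp p.2.2) hr0
  simp only [neg_mul] at h1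
  refine (h1.mul ((((hasDerivAt_id r).mul (S.hasDerivAt_u' p r)).sub (S.hasDerivAt_u p r)).add
    (((S.hasDerivAt_u p r).div (hasDerivAt_id r) hr0).const_mul
      (Real.exp p.2.2)))).congr_deriv ?_
  have h2 : pot p r = Real.exp p.2.2 ^ 2 / r ^ 4 - 2 * p.1 * Real.exp p.2.2 / r ^ 2 *
      Real.exp (-(p.2.1 * r ^ 2) / (2 * Real.exp p.2.2)) := by
    rw [pot, field, clip_of_mem hr, g_comp _ _ _ hr0, h_comp _ _ _ hr0]
    ring
  simp only [id, z, h2, Pi.div_apply, Pi.mul_apply, Pi.sub_apply, Pi.add_apply]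
  field_simp
  ring

theorem y_one (p : ℝ × ℝ × ℝ) : S.y p 1 = 1 := by simp [y, S.u_one, S.u'_one]

theorem z_one (p : ℝ × ℝ × ℝ) : S.z p 1 = 0 := by simp [z, S.u_one]

theorem y_two (p : ℝ × ℝ × ℝ) : S.y p 2 = S.G p := by
  have : -(Real.exp p.2.2 * (1 - 1 / 2)) = -(Real.exp p.2.2 / 2) := by ring
  rw [y, G, K, this]
  ring

theorem z_nonneg {p : ℝ × ℝ × ℝ} (hq : ∀ r, 0 ≤ pot p r) {r : ℝ} (hr : r ∈ Icc (1 : ℝ) 2) :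
    0 ≤ S.z p r := by
  have h1 := S.sub_one_le_u hq hr.1
  have h2 := hr.1
  have h3 : 0 ≤ S.u p r := by linarith
  unfold z
  positivity

theorem monotoneOn_Icc_of_hasDerivAt_nonneg {f f' : ℝ → ℝ} (hf : ∀ r ∈ Icc (1 : ℝ) 2, HasDerivAt f (f' r) r)
    (hf' : ∀ r ∈ Icc (1 : ℝ) 2, 0 ≤ f' r) : MonotoneOn f (Icc 1 2) := by
  refine monotoneOn_of_hasDerivWithinAt_nonneg (convex_Icc 1 2)
    (fun r hr => (hf r hr).continuousAt.continuousWithinAt)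
    (fun r hr => (hf r (interior_subset hr)).hasDerivWithinAt)
    fun r hr => hf' r (interior_subset hr)

theorem antitoneOn_y {p : ℝ × ℝ × ℝ} (ha : 0 ≤ p.1) (hq : ∀ r, 0 ≤ pot p r) :
    AntitoneOn (S.y p) (Icc 1 2) := by
  have h := monotoneOn_Icc_of_hasDerivAt_nonneg (fun r hr => (S.hasDerivAt_y p hr).neg) fun r hr => by
    have := S.z_nonneg hq hr
    rw [neg_neg]
    positivity
  exact fun r hr s hs hrs => neg_le_neg_iff.1 (h hr hs hrs)

/-- As `y` decreases from 1, z' ≤ 1, so z ≤ r - 1 ≤ 1, and then y' ≥ -2a·lam. -/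
theorem one_sub_le_G {p : ℝ × ℝ × ℝ} (ha : 0 ≤ p.1) (hb : 0 ≤ p.2.1) (hq : ∀ r, 0 ≤ pot p r) :
    1 - 2 * p.1 * Real.exp p.2.2 ≤ S.G p := by
  have h1m : (1 : ℝ) ∈ Icc (1 : ℝ) 2 := left_mem_Icc.2 one_le_two
  have h2m : (2 : ℝ) ∈ Icc (1 : ℝ) 2 := right_mem_Icc.2 one_le_two
  have hy1 : ∀ r ∈ Icc (1 : ℝ) 2, S.y p r ≤ 1 := fun r hr => by
    rw [← S.y_one p]; exact S.antitoneOn_y ha hq h1m hr hr.1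
  have hz1 : ∀ r ∈ Icc (1 : ℝ) 2, S.z p r ≤ 1 := by
    intro r hr
    have h := monotoneOn_Icc_of_hasDerivAt_nonneg
      (fun r hr => (hasDerivAt_id r).sub (S.hasDerivAt_z p hr)) (fun r hr => by
        have h0 : 1 ≤ r ^ 2 := one_le_pow₀ hr.1
        have h1 := mul_nonneg (Real.exp_pos p.2.2).le (S.z_nonneg hq hr)
        have h2 := hy1 r hr
        rw [sub_nonneg, div_le_one (by positivity)]
        linarith) h1m hr hr.1
    simp only [id, Pi.sub_apply, S.z_one] at h
    linarith [hr.2]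
  have h := monotoneOn_Icc_of_hasDerivAt_nonneg
    (fun r hr => (S.hasDerivAt_y p hr).add
      ((hasDerivAt_id r).const_mul (2 * p.1 * Real.exp p.2.2))) (fun r hr => by
      have h1 : Real.exp (-(p.2.1 * r ^ 2) / (2 * Real.exp p.2.2)) ≤ 1 := by
        rw [Real.exp_le_one_iff, neg_div, neg_nonpos]
        positivity
      have h2 : Real.exp (-(p.2.1 * r ^ 2) / (2 * Real.exp p.2.2)) * S.z p r ≤ 1 :=
        mul_le_one₀ h1 (S.z_nonneg hq hr) (hz1 r hr)
      have h3 : 0 ≤ 2 * p.1 * Real.exp p.2.2 := by positivity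
      nlinarith) h1m h2m one_le_two
  simp only [id, Pi.add_apply, S.y_one, S.y_two] at h
  linarith

/-- Since `y` decreases to `G`, y ≥ G throughout; this forces a lower bound on `z`, which in turn
forces `y` to drop by at least aG·exp(-2b/lam)(1 - 1/lam). -/
theorem G_mul_le {p : ℝ × ℝ × ℝ} (ha : 0 ≤ p.1) (hb : 0 ≤ p.2.1) (hq : ∀ r, 0 ≤ pot p r)
    (hG : 0 ≤ S.G p) :
    S.G p * (1 + p.1 * Real.exp (-(2 * p.2.1) / Real.exp p.2.2) * (1 - 1 / Real.exp p.2.2)) ≤ 1 := by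
  have h1m : (1 : ℝ) ∈ Icc (1 : ℝ) 2 := left_mem_Icc.2 one_le_two
  have h2m : (2 : ℝ) ∈ Icc (1 : ℝ) 2 := right_mem_Icc.2 one_le_two
  have hl : 0 < Real.exp p.2.2 := Real.exp_pos _
  have hyG : ∀ r ∈ Icc (1 : ℝ) 2, S.G p ≤ S.y p r := fun r hr => by
    rw [← S.y_two p]; exact S.antitoneOn_y ha hq hr h2m hr.2
  have hq' := fun r (hr : r ∈ Icc (1 : ℝ) 2) => S.hasDerivAt_y p hr
  have hq'' := fun r (hr : r ∈ Icc (1 : ℝ) 2) => S.hasDerivAt_z p hr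
  have hz0 := S.z_one p
  have hy1 := S.y_one p
  have hy2 := S.y_two p
  generalize hlam : Real.exp p.2.2 = lam at *
  have hz : ∀ r ∈ Icc (1 : ℝ) 2,
      S.G p / (2 * lam) * (1 - Real.exp (-(lam * (r - 1)))) ≤ S.z p r := by
    intro r hr
    have hr0 : 0 < r := by linarith [hr.1]
    -- exp(2lam(1 - 1/r)) is the integrating factor of z' = (y - 2lam·z)/r², and G/(2lam) is the
    -- stationary value of `z` when y = G.
    have h := monotoneOn_Icc_of_hasDerivAt_nonneg
      (fun r hr => (hasDerivAt_exp_one_sub (2 * lam) (by linarith [hr.1] : r ≠ 0)).mul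
        ((hq'' r hr).sub_const (S.G p / (2 * lam)))) (fun r hr => by
        have hr0 : 0 < r := by linarith [hr.1]
        have h1 : Real.exp (2 * lam * (1 - 1 / r)) * (2 * lam * (1 / r ^ 2)) *
            (S.z p r - S.G p / (2 * lam)) + Real.exp (2 * lam * (1 - 1 / r)) *
            ((S.y p r - 2 * lam * S.z p r) / r ^ 2) =
            Real.exp (2 * lam * (1 - 1 / r)) * ((S.y p r - S.G p) / r ^ 2) := by
          field_simp
          ring
        rw [h1]
        have := sub_nonneg.2 (hyG r hr)
        positivity) h1m hr hr.1
    simp only [Pi.mul_apply, hz0, div_one, sub_self, mul_zero, Real.exp_zero, one_mul] at h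
    have h2 : Real.exp (-(2 * lam * (1 - 1 / r))) ≤ Real.exp (-(lam * (r - 1))) := by
      rw [Real.exp_le_exp, neg_le_neg_iff]
      have h3 : (r - 1) / 2 ≤ 1 - 1 / r := by
        rw [show 1 - 1 / r = (r - 1) / r by field_simp]
        exact div_le_div_of_nonneg_left (by linarith [hr.1]) hr0 hr.2
      nlinarith
    have h4 : S.G p / (2 * lam) * (1 - Real.exp (-(2 * lam * (1 - 1 / r)))) ≤ S.z p r := by
      have h5 : Real.exp (-(2 * lam * (1 - 1 / r))) * Real.exp (2 * lam * (1 - 1 / r)) = 1 := by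
        rw [← Real.exp_add]; simp
      have h6 := mul_le_mul_of_nonneg_left h (Real.exp_pos (-(2 * lam * (1 - 1 / r)))).le
      rw [← mul_assoc, h5] at h6
      linarith
    refine le_trans ?_ h4
    have : 0 ≤ S.G p / (2 * lam) := by positivity
    gcongr
  set c := p.1 * Real.exp (-(2 * p.2.1) / lam) with hc
  have hc0 : 0 ≤ c := by positivity
  -- An explicit primitive of the lower bound just found for -y'; its increment over [1,2] is at
  -- least cG(1 - 1/lam).
  have hde : ∀ r : ℝ, HasDerivAt (fun r => c * S.G p * (r + Real.exp (-(lam * (r - 1))) / lam))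
      (c * S.G p * (1 - Real.exp (-(lam * (r - 1))))) r := by
    intro r
    have h1 : HasDerivAt (fun r : ℝ => -(lam * (r - 1))) (-lam) r := 
      (((hasDerivAt_id r).sub_const 1).const_mul lam).neg.congr_deriv (by ring)
    refine (((hasDerivAt_id r).add (h1.exp.div_const lam)).const_mul (c * S.G p)).congr_deriv ?_
    field_simp
    ring
  have h := monotoneOn_Icc_of_hasDerivAt_nonneg (fun r hr => ((hq' r hr).add (hde r)).neg) (fun r hr => by
    have h1 := hz r hr
    have h2 : Real.exp (-(2 * p.2.1) / lam) ≤ Real.exp (-(p.2.1 * r ^ 2) / (2 * lam)) := by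
      rw [Real.exp_le_exp, div_le_div_iff₀ hl (by positivity)]
      have h3 : r ^ 2 ≤ 4 := by nlinarith [hr.1, hr.2]
      have h4 := mul_le_mul_of_nonneg_left h3 (mul_nonneg hb hl.le)
      nlinarith
    have h5 : 0 ≤ 1 - Real.exp (-(lam * (r - 1))) := by
      rw [sub_nonneg, Real.exp_le_one_iff, neg_nonpos]
      exact mul_nonneg hl.le (by linarith [hr.1])
    have h6 : Real.exp (-(2 * p.2.1) / lam) * (S.G p / (2 * lam) * (1 - Real.exp (-(lam * (r - 1)))))
        ≤ Real.exp (-(p.2.1 * r ^ 2) / (2 * lam)) * S.z p r := by gcongr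
    have h7 := mul_le_mul_of_nonneg_left h6 (show 0 ≤ 2 * p.1 * lam by positivity)
    have h8 : 2 * p.1 * lam * (Real.exp (-(2 * p.2.1) / lam) *
        (S.G p / (2 * lam) * (1 - Real.exp (-(lam * (r - 1)))))) =
        c * S.G p * (1 - Real.exp (-(lam * (r - 1)))) := by
      rw [hc]; field_simp
    rw [h8] at h7
    linarith) h1m h2m one_le_two
  simp only [Pi.neg_apply, Pi.add_apply, hy1, hy2, sub_self, mul_zero, neg_zero, Real.exp_zero] at h
  have h9 : 0 ≤ c * S.G p * (Real.exp (-(lam * (2 - 1))) / lam) := by positivity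
  linarith

end ShootingFamily

end Estimates

/-! ### Sparking voltages, transversality and Sard's theorem -/

section Main

open Filter Topology

variable {a b γ : ℝ}

theorem pot_nonneg (ha : 0 < a) (hab : 4 / Real.exp 1 * a < b) (τ r : ℝ) :
    0 ≤ pot (a, b, τ) r :=
  neg_nonneg.2 (g_neg ha hab (field_pos _ _)).le

namespace ShootingFamily

variable (S : ShootingFamily)

theorem B_u (a b γ τ : ℝ) : B a b γ (Real.exp τ) (fun r => S.u (a, b, τ) r / r) =
    Real.exp (Real.exp τ / 2) / 4 * ((1 + γ) * S.G (a, b, τ) - γ) := by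
  have h : Real.exp (Real.exp τ / 2) * Real.exp (-(Real.exp τ / 2)) = 1 := by
    rw [← Real.exp_add]; simp
  rw [B_eq (S.isHomogeneous_u a b τ) (by simp [S.u_one])]
  simp only [S.u_one, S.u'_one, G, K]
  linear_combination (-(1 + γ) / 4 * (2 * S.u' (a, b, τ) 2 - S.u (a, b, τ) 2 +
    Real.exp τ / 2 * S.u (a, b, τ) 2)) * h

theorem exists_eq_of_isElectronSolution {τ : ℝ} {φ : ℝ → ℝ}
    (h : IsElectronSolution a b γ (Real.exp τ) φ) :
    ∃ c ≠ 0, ∀ r ∈ Icc (1 : ℝ) 2, φ r = c * (S.u (a, b, τ) r / r) := by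
  have hl := Real.exp_pos τ
  have hd := (h.isHomogeneous hl).add ((S.isHomogeneous_u a b τ).const_mul (-dr φ 1))
  have hz : EqOn (fun r => φ r + -dr φ 1 * (S.u (a, b, τ) r / r)) 0 (Icc 1 2) := by
    refine RadialEq.eqOn_zero (w := fun r => -(r ^ 2 * g a b (Real.exp τ * dH r)))
      (hd.congr (fun _ _ => rfl) (fun _ _ => rfl) fun r _ => by simp only; ring)
      (((continuousOn_pow 2).mul (continuousOn_g_comp a b hl)).neg) (Or.inl ⟨?_, ?_⟩)
    · simp only [S.u_one, h.anode]; ring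
    · simp only [S.u_one, S.u'_one]; ring
  have hφ : ∀ r ∈ Icc (1 : ℝ) 2, φ r = dr φ 1 * (S.u (a, b, τ) r / r) := by
    intro r hr
    have := hz hr
    simp only [Pi.zero_apply] at this
    linear_combination this
  refine ⟨dr φ 1, fun h0 => ?_, hφ⟩
  have h1 := h.pos (3 / 2) (by norm_num)
  rw [hφ (3 / 2) (by norm_num), h0, zero_mul] at h1
  exact lt_irrefl _ h1

theorem isHomogeneous_of_eq {τ c : ℝ} {φ : ℝ → ℝ}
    (h : ∀ r ∈ Icc (1 : ℝ) 2, φ r = c * (S.u (a, b, τ) r / r)) :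
    IsHomogeneous a b (Real.exp τ) φ
      (fun r => c * (S.u' (a, b, τ) r / r - S.u (a, b, τ) r / r ^ 2)) :=
  ((S.isHomogeneous_u a b τ).const_mul c).congr h (fun _ _ => rfl) fun r hr => by
    simp only [h r hr]; ring

theorem G_eq_of_isElectronSolution {τ : ℝ} {φ : ℝ → ℝ}
    (h : IsElectronSolution a b γ (Real.exp τ) φ) : (1 + γ) * S.G (a, b, τ) = γ := by
  obtain ⟨c, hc, hφ⟩ := S.exists_eq_of_isElectronSolution h
  have h1 := h.cathode
  have h2 := S.B_u a b γ τ
  rw [B_eq (S.isHomogeneous_u a b τ) (by simp [S.u_one])] at h2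
  rw [B_eq (S.isHomogeneous_of_eq hφ) h.anode, hφ 2 (right_mem_Icc.2 one_le_two)] at h1
  have h3 : c * (Real.exp (Real.exp τ / 2) / 4 * ((1 + γ) * S.G (a, b, τ) - γ)) = 0 := by
    linear_combination h1 - c * h2
  have h4 := (Real.exp_pos (Real.exp τ / 2)).ne'
  rcases mul_eq_zero.1 h3 with h5 | h5
  · exact absurd h5 hc
  · rcases mul_eq_zero.1 h5 with h6 | h6
    · exact absurd h6 (by positivity)
    · linarith

theorem isElectronSolution_u (ha : 0 < a) (hab : 4 / Real.exp 1 * a < b) {τ : ℝ}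
    (hG : (1 + γ) * S.G (a, b, τ) = γ) :
    IsElectronSolution a b γ (Real.exp τ) (fun r => S.u (a, b, τ) r / r) where
  memH2 := (S.isHomogeneous_u a b τ).memH2
  eqn := (S.isHomogeneous_u a b τ).negRadialLaplacianEq
  anode := by simp [S.u_one]
  pos r hr := by
    have h1 := S.sub_one_le_u (pot_nonneg ha hab τ) hr.1.le
    exact div_pos (by linarith [hr.1]) (by linarith [hr.1])
  cathode := by rw [S.B_u, hG, sub_self, mul_zero]

theorem sparkingVoltages_eq (ha : 0 < a) (hab : 4 / Real.exp 1 * a < b) :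
    sparkingVoltages a b γ = Real.exp '' {τ | (1 + γ) * S.G (a, b, τ) = γ} := by
  ext lam
  constructor
  · rintro ⟨hl, φ, hφ⟩
    rw [← Real.exp_log hl] at hφ
    exact ⟨Real.log lam, S.G_eq_of_isElectronSolution hφ, Real.exp_log hl⟩
  · rintro ⟨τ, hτ, rfl⟩
    exact ⟨Real.exp_pos τ, _, S.isElectronSolution_u ha hab hτ⟩

/-- As lam grows, γa·exp(-2b/lam)(1 - 1/lam) tends to γa > 1. Once it exceeds 1, having (1+γ)G > γ
would contradict `G_mul_le`. -/
theorem exists_G_le (ha : 0 < a) (hab : 4 / Real.exp 1 * a < b) (hγ : 0 < γ) (haγ : 1 / a < γ) :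
    ∃ τ, (1 + γ) * S.G (a, b, τ) ≤ γ := by
  have hb : 0 < b := lt_trans (by positivity) hab
  have h1 : Tendsto (fun lam : ℝ => γ * (a * Real.exp (-(2 * b) / lam) * (1 - 1 / lam))) atTop
      (𝓝 (γ * (a * Real.exp 0 * (1 - 0)))) := by
    refine Tendsto.const_mul _ (Tendsto.mul (Tendsto.const_mul _ ?_) (Tendsto.const_sub _ ?_))
    · exact (Real.continuous_exp.tendsto 0).comp (tendsto_const_nhds.div_atTop tendsto_id)
    · exact tendsto_const_nhds.div_atTop tendsto_id
  have h2 : 1 < γ * (a * Real.exp 0 * (1 - 0)) := by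
    rw [div_lt_iff₀ ha] at haγ
    simpa using haγ
  obtain ⟨τ, hτ⟩ := (Real.tendsto_exp_atTop.eventually (h1.eventually_const_lt h2)).exists
  refine ⟨τ, ?_⟩
  by_contra! hlt
  have hG : 0 < S.G (a, b, τ) := by
    by_contra! h0
    nlinarith
  have h3 := S.G_mul_le ha.le hb.le (pot_nonneg ha hab τ) hG.le
  simp only at h3
  nlinarith

theorem exists_isLeast (ha : 0 < a) (hab : 4 / Real.exp 1 * a < b) (hγ : 0 < γ)
    (haγ : 1 / a < γ) : ∃ τ, IsLeast {τ | (1 + γ) * S.G (a, b, τ) = γ} τ := by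
  have hb : 0 < b := lt_trans (by positivity) hab
  have hlow : ∀ τ, 1 - 2 * a * Real.exp τ ≤ S.G (a, b, τ) := fun τ =>
    S.one_sub_le_G ha.le hb.le (pot_nonneg ha hab τ)
  have hc : Continuous fun τ => (1 + γ) * S.G (a, b, τ) :=
    continuous_const.mul (S.continuous_G.comp (by fun_prop))
  -- The voltage at which 1 - 2a·lam equals γ/(1+γ). It supplies the upper value for the
  -- intermediate value theorem and also bounds all roots from below.
  have hpos : 0 < 1 / (2 * a * (1 + γ)) := by positivity
  have hne : {τ | (1 + γ) * S.G (a, b, τ) = γ}.Nonempty := by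
    refine mem_range_of_exists_le_of_exists_ge hc (S.exists_G_le ha hab hγ haγ)
      ⟨Real.log (1 / (2 * a * (1 + γ))), ?_⟩
    have h1 := hlow (Real.log (1 / (2 * a * (1 + γ))))
    rw [Real.exp_log hpos] at h1
    have h2 := mul_le_mul_of_nonneg_left h1 (show 0 ≤ 1 + γ by positivity)
    have h3 : (1 + γ) * (1 - 2 * a * (1 / (2 * a * (1 + γ)))) = γ := by
      field_simp
      ring
    linarith
  have hbdd : BddBelow {τ | (1 + γ) * S.G (a, b, τ) = γ} := by
    refine ⟨Real.log (1 / (2 * a * (1 + γ))), fun τ hτ => ?_⟩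
    rw [Real.log_le_iff_le_exp hpos, div_le_iff₀ (by positivity)]
    have h2 := mul_le_mul_of_nonneg_left (hlow τ) (show 0 ≤ 1 + γ by positivity)
    rw [show (1 + γ) * S.G (a, b, τ) = γ from hτ] at h2
    linarith
  exact ⟨_, (isClosed_eq hc continuous_const).csInf_mem hne hbdd,
    fun _ hτ => csInf_le hbdd hτ⟩

/-- Both sides measure the variation of the same scalar equation with the voltage; the factor exp τ
appears because `G'` differentiates in τ = log lam. -/
theorem F_eq_G' {τ c d : ℝ} {φ ψ : ℝ → ℝ}
    (hφ : ∀ r ∈ Icc (1 : ℝ) 2, φ r = c * (S.u (a, b, τ) r / r))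
    (hψ : ∀ r ∈ Icc (1 : ℝ) 2, ψ r =
      d * ((1 + γ) * (S.w (a, b, τ) r / r) - γ * radialExp (Real.exp τ) r)) :
    Real.exp τ * F a b γ (Real.exp τ) φ ψ =
      d * (1 + γ) * c * (Real.exp (Real.exp τ / 2) * S.G' (a, b, τ)) := by
  have h : Real.exp (Real.exp τ / 2) * Real.exp (-(Real.exp τ / 2)) = 1 := by
    rw [← Real.exp_add]; simp
  have h2m : (2 : ℝ) ∈ Icc (1 : ℝ) 2 := right_mem_Icc.2 one_le_two
  have hI : c * (∫ r in (1 : ℝ)..2, potDeriv (a, b, τ) r * S.u (a, b, τ) r * S.w (a, b, τ) r) =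
      -(Real.exp τ) * ∫ r in (1 : ℝ)..2, r ^ 2 * (S.w (a, b, τ) r / r) *
        deriv (g a b) (Real.exp τ * dH r) * dH r * φ r := by
    rw [← intervalIntegral.integral_const_mul, ← intervalIntegral.integral_const_mul]
    refine intervalIntegral.integral_congr fun r hr => ?_
    rw [uIcc_of_le one_le_two] at hr
    have hr0 : r ≠ 0 := by linarith [hr.1]
    have hf : field (a, b, τ) r = Real.exp τ * dH r := by rw [field, clip_of_mem hr]
    simp only [potDeriv, hf, hφ r hr, deriv_g_eq a b (mul_pos (Real.exp_pos τ) (dH_pos hr)).ne']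
    generalize dH r = D
    field_simp
  rw [F_eq (Real.exp_pos τ) (S.isHomogeneous_of_eq hφ)
    (by rw [hφ 1 (left_mem_Icc.2 one_le_two), S.u_one]; simp)
    (S.isHomogeneous_w a b τ).continuousOn (by simp [S.w_two]) hψ, hφ 2 h2m]
  simp only [G', K', K]
  linear_combination (-(d * (1 + γ))) * hI - d * (1 + γ) * c * (Real.exp τ * (S.u (a, b, τ) 2 / 2) +
    (∫ r in (1 : ℝ)..2, potDeriv (a, b, τ) r * S.u (a, b, τ) r * S.w (a, b, τ) r) -
    Real.exp τ / 2 * (2 * S.u' (a, b, τ) 2 - S.u (a, b, τ) 2 +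
      Real.exp τ / 2 * S.u (a, b, τ) 2)) * h

theorem transversalityCondition (ha : 0 < a) (hab : 4 / Real.exp 1 * a < b) (hγ : 0 < γ)
    (haγ : 1 / a < γ) (hreg : ∀ τ, (1 + γ) * S.G (a, b, τ) = γ → S.G' (a, b, τ) ≠ 0) :
    TransversalityCondition a b γ := by
  obtain ⟨τ, hτ⟩ := S.exists_isLeast ha hab hγ haγ
  have hV : sparkingVoltage a b γ = Real.exp τ := by
    rw [sparkingVoltage, S.sparkingVoltages_eq ha hab]
    exact IsLeast.csInf_eq ⟨mem_image_of_mem _ hτ.1, by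
      rintro _ ⟨σ, hσ, rfl⟩
      exact Real.exp_le_exp.2 (hτ.2 hσ)⟩
  have hl := Real.exp_pos τ
  have hG : (1 + γ) * S.G (a, b, τ) = γ := hτ.1
  have hw2 : S.w (a, b, τ) 2 / 2 = 1 := by simp [S.w_two]
  have hw2' : S.w' (a, b, τ) 2 / 2 - S.w (a, b, τ) 2 / 2 ^ 2 = -(Real.exp τ / 4) := by
    simp only [S.w_two, S.w'_two]; ring
  have h : Real.exp (Real.exp τ / 2) * Real.exp (-(Real.exp τ / 2)) = 1 := by
    rw [← Real.exp_add]; simp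
  rw [TransversalityCondition, hV]
  refine ⟨hl, ⟨_, S.isElectronSolution_u ha hab hG⟩, ⟨_, isAdjointSolution_of_isHomogeneous
    (S.isHomogeneous_w a b τ) hw2 hw2' ?_, 2, right_mem_Icc.2 one_le_two, ?_⟩, ?_⟩
  · simp only [div_one, ← S.K_eq_w_one]
    simp only [G] at hG
    linear_combination (-(1 + γ) * S.K (a, b, τ)) * h + Real.exp (Real.exp τ / 2) * hG
  · simp only [hw2, radialExp_two]
    norm_num
  · intro φ ψ hφ hψ hne hF
    obtain ⟨c, hc, hφ'⟩ := S.exists_eq_of_isElectronSolution hφ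
    obtain ⟨d, hd, hψ'⟩ := hψ.exists_eq hl hne (S.isHomogeneous_w a b τ) hw2 hw2'
    have h1 := S.F_eq_G' hφ' hψ'
    rw [hF, mul_zero] at h1
    have h2 : d * (1 + γ) * c * (Real.exp (Real.exp τ / 2) * S.G' (a, b, τ)) ≠ 0 := by
      have := hreg τ hG
      have h3 : 1 + γ ≠ 0 := by positivity
      positivity
    exact h2 h1.symm

/-- The parameters for which some voltage is a degenerate solution. -/
def degenerate : Set (ℝ × ℝ × ℝ) :=
  {p | ∃ τ, (1 + p.2.2) * S.G (p.1, p.2.1, τ) = p.2.2 ∧ S.G' (p.1, p.2.1, τ) = 0}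

/-- The set is the projection of a closed subset of a σ-compact space, hence a countable union of
compact sets. Measurability is needed for Fubini's theorem. -/
theorem measurableSet_degenerate : MeasurableSet S.degenerate := by
  set C : Set ((ℝ × ℝ × ℝ) × ℝ) := {x | (1 + x.1.2.2) * S.G (x.1.1, x.1.2.1, x.2) = x.1.2.2 ∧
    S.G' (x.1.1, x.1.2.1, x.2) = 0} with hC
  have hm : Continuous fun x : (ℝ × ℝ × ℝ) × ℝ => (x.1.1, x.1.2.1, x.2) := by fun_prop
  have hCc : IsClosed C := by
    refine (isClosed_eq ?_ (by fun_prop)).inter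
      (isClosed_eq (S.continuous_G'.comp hm) continuous_const)
    exact Continuous.mul (by fun_prop) (S.continuous_G.comp hm)
  have himg : S.degenerate = Prod.fst '' C := by
    ext p
    simp [degenerate, hC]
  have hσ : IsSigmaCompact (Prod.fst '' C) :=
    (isSigmaCompact_univ.of_isClosed_subset hCc (subset_univ _)).image continuous_fst
  obtain ⟨k, hk, hku⟩ := hσ
  rw [himg, ← hku]
  exact MeasurableSet.iUnion fun n => (hk n).measurableSet

/-- Sard's theorem for the map `τ ↦ G / (1 - G)` at fixed `a`, `b`. -/
theorem volume_degenerate_section (a b : ℝ) :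
    volume {γ : ℝ | (a, b, γ) ∈ S.degenerate} = 0 := by
  set s : Set ℝ := {τ | 1 - S.G (a, b, τ) ≠ 0 ∧ S.G' (a, b, τ) = 0} with hs
  have h1 : volume ((fun τ => S.G (a, b, τ) / (1 - S.G (a, b, τ))) '' s) = 0 := by
    refine addHaar_image_eq_zero_of_det_fderivWithin_eq_zero volume
      (f' := fun _ => (0 : ℝ →L[ℝ] ℝ)) (fun τ hτ => ?_) fun τ _ => by
        simp [ContinuousLinearMap.det]
    have h2 := S.hasDerivAt_G a b τ
    rw [hτ.2] at h2
    have h3 := (h2.div (h2.const_sub 1) hτ.1).hasDerivWithinAt (s := s)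
    simp only [zero_mul, neg_zero, mul_zero, sub_self, zero_div] at h3
    have h4 := h3.hasFDerivWithinAt
    rw [ContinuousLinearMap.toSpanSingleton_zero] at h4
    exact h4
  refine measure_mono_null ?_ h1
  rintro γ ⟨τ, hτ, hτ'⟩
  simp only at hτ hτ'
  -- G = 1 would turn the root equation into 1 + γ = γ, so γ = G/(1 - G) is a genuine value of the
  -- map.
  have h5 : 1 - S.G (a, b, τ) ≠ 0 := fun h0 => by
    have h6 : S.G (a, b, τ) = 1 := by linarith
    rw [h6] at hτ
    linarith
  refine ⟨τ, ⟨h5, hτ'⟩, ?_⟩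
  simp only
  rw [div_eq_iff h5]
  linarith

theorem volume_degenerate : volume S.degenerate = 0 := by
  rw [Measure.volume_eq_prod, Measure.measure_prod_null S.measurableSet_degenerate]
  refine Eventually.of_forall fun a => ?_
  simp only [Pi.zero_apply]
  rw [Measure.volume_eq_prod,
    Measure.measure_prod_null (measurable_prodMk_left S.measurableSet_degenerate)]
  exact Eventually.of_forall fun b => S.volume_degenerate_section a b

end ShootingFamily

end Main

end GasDischarge

end

theorem theorem2p2 :
    GasDischarge.Gam ⊆ GasDischarge.sparkingParameterSet ∧
    ∀ᵐ p : ℝ × ℝ × ℝ ∂MeasureTheory.volume, p ∈ GasDischarge.Gam →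
      GasDischarge.TransversalityCondition p.1 p.2.1 p.2.2 := by
  obtain ⟨S⟩ := GasDischarge.nonempty_shootingFamily
  refine ⟨?_, ?_⟩
  · rintro p ⟨ha, hb, hγ, haγ, hab⟩
    refine ⟨ha, hb, hγ, ?_⟩
    obtain ⟨τ, hτ⟩ := S.exists_isLeast ha hab hγ haγ
    rw [S.sparkingVoltages_eq ha hab]
    exact ⟨_, Set.mem_image_of_mem _ hτ.1⟩
  · filter_upwards [MeasureTheory.measure_eq_zero_iff_ae_notMem.1 S.volume_degenerate] with p hp
    rintro ⟨ha, -, hγ, haγ, hab⟩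
    exact S.transversalityCondition ha hab hγ haγ fun τ hτ h0 => hp ⟨τ, hτ, h0⟩
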